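/- Let $(B,g_B)$ be a compact connected Riemannian manifold of dimension $1$ (without boundary), let $k\ge 1$, and let $(F,g_F)$ be a connected pseudo-Riemannian manifold of dimension $k$ which is Einstein with $\nu\in C^\infty(F)$, i.e. $\mathrm{Ric}_{g_F}=\nu\, g_F$. Let $\mu\in\mathbb R\setminus\{0,\,1,\,k,\,k-\sqrt{k^2-k},\,k+\sqrt{k^2-k}\}$, let $\psi\in C^\infty(B)$ with $\psi>0$, and let $M=B\times F$ carry the metric $g=\psi^{2\mu}g_B\oplus\psi^2 g_F$ (the $(\psi,\mu)$-base conformal warped product). Let $\lambda: M\to\mathbb R$ be a function, assumed to be constant if $k=1$. Then $(M,g)$ is Einstein with $\lambda$ (i.e. $\lambda\in C^\infty(M)$ and $\mathrm{Ric}_g=\lambda g$) if and only if $\lambda= 0$ on $M$, $\nu= 0$ on $F$, and $\psi$ is a positive constant. In particular, in that case $(M,g)$ is a trivial product: $g=\pi^*g_B'+\sigma^*g_F'$, where $\pi,\sigma$ are the projections of $M$ to $B,F$ and $g_B'$, $g_F'$ are positive constant multiples of $g_B$, $g_F$. -/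

import Mathlib

set_option maxSynthPendingDepth 3

open Bundle
open scoped Manifold ContDiff Topology

noncomputable section

open ContinuousLinearMap

/-! ### Curvature of a metric on an open piece of a normed space -/

namespace LocalMetric

variable {E : Type*} [NormedAddCommGroup E] [NormedSpace ℝ E]

/-- The Christoffel symbols of the first kind of `g : E → Bil(E)` at `y`: the covector
`koszul g y u v = ½ (∂_u g(v, ·) + ∂_v g(u, ·) - ∂_· g(u, v))`, as a bilinear map in `u`, `v`. -/
def koszul (g : E → E →L[ℝ] E →L[ℝ] ℝ) (y : E) : E →L[ℝ] E →L[ℝ] (E →L[ℝ] ℝ) :=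
  (2⁻¹ : ℝ) • (fderiv ℝ g y + (fderiv ℝ g y).flip -
    ((flipₗᵢ ℝ E E ℝ : (E →L[ℝ] E →L[ℝ] ℝ) ≃L[ℝ] (E →L[ℝ] E →L[ℝ] ℝ)) :
      (E →L[ℝ] E →L[ℝ] ℝ) →L[ℝ] (E →L[ℝ] E →L[ℝ] ℝ)) ∘L (fderiv ℝ g y).flip)

theorem koszul_apply (g : E → E →L[ℝ] E →L[ℝ] ℝ) (y u v w : E) :
    koszul g y u v w =
      2⁻¹ * (fderiv ℝ g y u v w + fderiv ℝ g y v u w - fderiv ℝ g y w u v) := by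
  simp [koszul]

/-- The Christoffel symbols (of the second kind) of `g` at `y`, i.e. the Levi-Civita connection
`∇_u v = christoffel g y u v` of constant vector fields: the vector `z` with
`g y z w = koszul g y u v w` for all `w`. -/
def christoffel (g : E → E →L[ℝ] E →L[ℝ] ℝ) (y : E) : E →L[ℝ] E →L[ℝ] E :=
  ((g y).inverse.postcomp E) ∘L koszul g y

theorem christoffel_apply (g : E → E →L[ℝ] E →L[ℝ] ℝ) (y u v : E) :
    christoffel g y u v = (g y).inverse (koszul g y u v) := rfl

/-- The curvature `R(u, v) w = ∇_u ∇_v w - ∇_v ∇_u w` (for constant vector fields). -/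
def curvature (g : E → E →L[ℝ] E →L[ℝ] ℝ) (y u v w : E) : E :=
  fderiv ℝ (christoffel g) y u v w - fderiv ℝ (christoffel g) y v u w
    + christoffel g y u (christoffel g y v w) - christoffel g y v (christoffel g y u w)

/-- The Ricci curvature `Ric(v, w)`: the trace of `u ↦ R(u, v) w`. -/
def ricci (g : E → E →L[ℝ] E →L[ℝ] ℝ) (y v w : E) : ℝ :=
  LinearMap.trace ℝ E
    { toFun := fun u => curvature g y u v w
      map_add' := fun a b => by simp only [curvature, map_add, add_apply]; abel
      map_smul' := fun c a => by
        simp only [curvature, map_smul, smul_apply, RingHom.id_apply, smul_sub, smul_add] }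

end LocalMetric

/-- The pullback of a bilinear form by a linear map. -/
def pullbackForm {V W : Type*} [AddCommGroup V] [Module ℝ V] [TopologicalSpace V]
    [IsTopologicalAddGroup V] [ContinuousSMul ℝ V]
    [AddCommGroup W] [Module ℝ W] [TopologicalSpace W]
    [IsTopologicalAddGroup W] [ContinuousSMul ℝ W]
    (A : V →L[ℝ] W) (b : W →L[ℝ] W →L[ℝ] ℝ) : V →L[ℝ] V →L[ℝ] ℝ :=
  (A.precomp ℝ) ∘L b ∘L A

/-! ### Pseudo-Riemannian manifolds and Einstein manifolds -/

section Manifold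

variable {E : Type*} [NormedAddCommGroup E] [NormedSpace ℝ E]
  {H : Type*} [TopologicalSpace H] (I : ModelWithCorners ℝ E H)
  (M : Type*) [TopologicalSpace M] [ChartedSpace H M] [IsManifold I ∞ M]

/-- A smooth pseudo-Riemannian metric on a manifold: a smooth field of nondegenerate symmetric
bilinear forms on the tangent spaces. -/
structure PseudoRiemannianMetric where
  val (x : M) : TangentSpace I x →L[ℝ] TangentSpace I x →L[ℝ] ℝ
  symm (x : M) (v w : TangentSpace I x) : val x v w = val x w v
  nondegenerate (x : M) (v : TangentSpace I x) (hv : ∀ w, val x v w = 0) : v = 0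
  contMDiff : ContMDiff I (I.prod 𝓘(ℝ, E →L[ℝ] E →L[ℝ] ℝ)) ∞
    (fun x ↦ TotalSpace.mk' (E →L[ℝ] E →L[ℝ] ℝ)
      (E := fun x : M ↦ TangentSpace I x →L[ℝ] TangentSpace I x →L[ℝ] ℝ) x (val x))

variable {I M}

/-- A Riemannian metric, regarded as a pseudo-Riemannian metric. -/
def PseudoRiemannianMetric.ofRiemannian
    (g : ContMDiffRiemannianMetric I ∞ E (fun x : M ↦ TangentSpace I x)) :
    PseudoRiemannianMetric I M where
  val := g.inner
  symm := g.symm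
  nondegenerate x v hv := by
    by_contra h
    exact (g.pos x v h).ne' (hv v)
  contMDiff := g.contMDiff

namespace PseudoRiemannianMetric

/-- The metric read in the chart at `x₀`, as a function on (the target of the chart in) the model
vector space: the pullback of `g` by the inverse of the chart. -/
def inChart (g : PseudoRiemannianMetric I M) (x₀ : M) (y : E) : E →L[ℝ] E →L[ℝ] ℝ :=
  pullbackForm (V := E) (mfderiv 𝓘(ℝ, E) I (extChartAt I x₀).symm y)
    (g.val ((extChartAt I x₀).symm y))

/-- The Ricci curvature at `x`, computed in the chart at `x` (for a manifold without boundary of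
finite dimension). -/
def ricci (g : PseudoRiemannianMetric I M) (x : M) (v w : TangentSpace I x) : ℝ :=
  LocalMetric.ricci (g.inChart x) (extChartAt I x x)
    (mfderiv I 𝓘(ℝ, E) (extChartAt I x) x v) (mfderiv I 𝓘(ℝ, E) (extChartAt I x) x w)

/-- `(M, g)` is an Einstein manifold with `lam ∈ C^∞(M)`: `Ric = lam g`. -/
def IsEinstein (g : PseudoRiemannianMetric I M) (lam : M → ℝ) : Prop :=
  ContMDiff I 𝓘(ℝ, ℝ) ∞ lam ∧
    ∀ (x : M) (v w : TangentSpace I x), g.ricci x v w = lam x * g.val x v w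

end PseudoRiemannianMetric

end Manifold

/-! ### Base conformal warped products -/

section WarpedProduct

theorem ContMDiff.rpow_const_of_pos {E : Type*} [NormedAddCommGroup E] [NormedSpace ℝ E]
    {H : Type*} [TopologicalSpace H] {I : ModelWithCorners ℝ E H}
    {M : Type*} [TopologicalSpace M] [ChartedSpace H M]
    {f : M → ℝ} (hf : ContMDiff I 𝓘(ℝ, ℝ) ∞ f)
    (hf₀ : ∀ x, 0 < f x) (s : ℝ) : ContMDiff I 𝓘(ℝ, ℝ) ∞ (fun x ↦ f x ^ s) := fun x ↦
  ContMDiffAt.comp (I' := 𝓘(ℝ, ℝ)) (g := fun t : ℝ ↦ t ^ s) x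
    (Real.contDiffAt_rpow_const_of_ne (hf₀ x).ne').contMDiffAt (hf x)

variable {E : Type*} [NormedAddCommGroup E] [NormedSpace ℝ E]
  {H : Type*} [TopologicalSpace H] {I : ModelWithCorners ℝ E H}
  {M : Type*} [TopologicalSpace M] [ChartedSpace H M] [IsManifold I ∞ M]
  {E' : Type*} [NormedAddCommGroup E'] [NormedSpace ℝ E']
  {H' : Type*} [TopologicalSpace H'] {J : ModelWithCorners ℝ E' H'}
  {N : Type*} [TopologicalSpace N] [ChartedSpace H' N] [IsManifold J ∞ N]

/-- Pullbacks of smooth fields of bilinear forms by smooth maps are smooth. -/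
theorem contMDiff_pullbackForm {f : N → M} (hf : ContMDiff J I ∞ f)
    (b : ∀ x : M, TangentSpace I x →L[ℝ] TangentSpace I x →L[ℝ] ℝ)
    (hb : ContMDiff I (I.prod 𝓘(ℝ, E →L[ℝ] E →L[ℝ] ℝ)) ∞
      (fun x ↦ TotalSpace.mk' (E →L[ℝ] E →L[ℝ] ℝ)
        (E := fun x : M ↦ TangentSpace I x →L[ℝ] TangentSpace I x →L[ℝ] ℝ) x (b x))) :
    ContMDiff J (J.prod 𝓘(ℝ, E' →L[ℝ] E' →L[ℝ] ℝ)) ∞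
      (fun z ↦ TotalSpace.mk' (E' →L[ℝ] E' →L[ℝ] ℝ)
        (E := fun z : N ↦ TangentSpace J z →L[ℝ] TangentSpace J z →L[ℝ] ℝ) z
        (pullbackForm (mfderiv J I f z) (b (f z)))) := by
  intro z₀
  have hA := (hf z₀).mfderiv_const (m := ∞) le_rfl
  have hG := (hb (f z₀))
  rw [contMDiffAt_hom_bundle] at hG ⊢
  refine ⟨contMDiffAt_id, ?_⟩
  have hG' := hG.2.comp z₀ (hf z₀)
  have key := (hA.clm_precomp (F₃ := ℝ)).clm_comp (hG'.clm_comp hA)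
  refine key.congr_of_eventuallyEq ?_
  have h1 : ∀ᶠ z in 𝓝 z₀, z ∈ (trivializationAt E' (TangentSpace J) z₀).baseSet :=
    (trivializationAt E' (TangentSpace J) z₀).open_baseSet.mem_nhds
      (FiberBundle.mem_baseSet_trivializationAt' z₀)
  have h2 : ∀ᶠ z in 𝓝 z₀, f z ∈ (trivializationAt E (TangentSpace I) (f z₀)).baseSet :=
    hf.continuous.continuousAt.preimage_mem_nhds
      ((trivializationAt E (TangentSpace I) (f z₀)).open_baseSet.mem_nhds
        (FiberBundle.mem_baseSet_trivializationAt' (f z₀)))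
  filter_upwards [h1, h2] with z hz hfz
  ext u v
  rw [inCoordinates_apply_eq₂ hz hz (Set.mem_univ _)]
  have hsymm : ∀ a : E', (trivializationAt E (TangentSpace I) (f z₀)).symm (f z)
      (inTangentCoordinates J I id f (fun z ↦ mfderiv J I f z) z₀ z a) =
      mfderiv J I f z ((trivializationAt E' (TangentSpace J) z₀).symm z a) := by
    intro a
    simp only [inTangentCoordinates, inCoordinates, id, comp_apply]
    rw [← Trivialization.symmL_apply (R := ℝ) (trivializationAt E (TangentSpace I) (f z₀)) hfz,
      ← Trivialization.symmL_apply (R := ℝ) (trivializationAt E' (TangentSpace J) z₀) hz]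
    exact Trivialization.symmL_continuousLinearMapAt _ hfz _
  change _ = inCoordinates E (TangentSpace I) (E →L[ℝ] ℝ) (fun x ↦ TangentSpace I x →L[ℝ] ℝ)
    (f z₀) (f z) (f z₀) (f z) (b (f z))
    (inTangentCoordinates J I id f (fun z ↦ mfderiv J I f z) z₀ z u)
    (inTangentCoordinates J I id f (fun z ↦ mfderiv J I f z) z₀ z v)
  rw [inCoordinates_apply_eq₂ hfz hfz (Set.mem_univ _), hsymm, hsymm]
  rfl

/-- The base conformal warped product `(M × N, c² g_M ⊕ w² g_N)`: the metric
`(c ∘ π)² π^* g_M + (w ∘ σ)² σ^* g_N` with `c, w : M → (0, ∞)` smooth, where `π : M × N → M` and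
`σ : M × N → N` are the projections. -/
def bcwp (g : PseudoRiemannianMetric I M) (h : PseudoRiemannianMetric J N) (c w : M → ℝ)
    (hc : ContMDiff I 𝓘(ℝ, ℝ) ∞ c) (hc₀ : ∀ x, 0 < c x)
    (hw : ContMDiff I 𝓘(ℝ, ℝ) ∞ w) (hw₀ : ∀ x, 0 < w x) :
    PseudoRiemannianMetric (I.prod J) (M × N) where
  val z :=
    (c z.1) ^ 2 • pullbackForm (mfderiv (I.prod J) I Prod.fst z) (g.val z.1) +
      (w z.1) ^ 2 • pullbackForm (mfderiv (I.prod J) J Prod.snd z) (h.val z.2)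
  symm z u v := by
    change c z.1 ^ 2 * g.val z.1 _ _ + w z.1 ^ 2 * h.val z.2 _ _ =
      c z.1 ^ 2 * g.val z.1 _ _ + w z.1 ^ 2 * h.val z.2 _ _
    rw [g.symm, h.symm]
  nondegenerate z u hu := by
    have key : ∀ v : TangentSpace (I.prod J) z,
        c z.1 ^ 2 * g.val z.1 (mfderiv (I.prod J) I Prod.fst z u)
            (mfderiv (I.prod J) I Prod.fst z v) +
          w z.1 ^ 2 * h.val z.2 (mfderiv (I.prod J) J Prod.snd z u)
            (mfderiv (I.prod J) J Prod.snd z v) = 0 := hu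
    simp only [mfderiv_fst, mfderiv_snd] at key
    have h1 : u.1 = 0 := by
      refine g.nondegenerate z.1 u.1 fun v => ?_
      have := key (v, (0 : E'))
      change c z.1 ^ 2 * g.val z.1 u.1 v + w z.1 ^ 2 * h.val z.2 u.2 0 = 0 at this
      simpa [(hc₀ z.1).ne'] using this
    have h2 : u.2 = 0 := by
      refine h.nondegenerate z.2 u.2 fun v => ?_
      have := key ((0 : E), v)
      change c z.1 ^ 2 * g.val z.1 u.1 0 + w z.1 ^ 2 * h.val z.2 u.2 v = 0 at this
      simpa [(hw₀ z.1).ne'] using this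
    exact Prod.ext h1 h2
  contMDiff := by
    refine ContMDiff.add_section (ContMDiff.smul_section ((hc.comp contMDiff_fst).pow 2) ?_)
      (ContMDiff.smul_section ((hw.comp contMDiff_fst).pow 2) ?_)
    · exact contMDiff_pullbackForm contMDiff_fst g.val g.contMDiff
    · exact contMDiff_pullbackForm contMDiff_snd h.val h.contMDiff

/-- The (unwarped) product of two pseudo-Riemannian manifolds: the metric `π^* g_M + σ^* g_N`. -/
def productMetric (g : PseudoRiemannianMetric I M) (h : PseudoRiemannianMetric J N) :
    PseudoRiemannianMetric (I.prod J) (M × N) :=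
  bcwp g h (fun _ ↦ 1) (fun _ ↦ 1) contMDiff_const (fun _ ↦ one_pos) contMDiff_const
    (fun _ ↦ one_pos)

/-- The special base conformal warped product `(ψ, μ)-bcwp`: the metric `ψ^{2μ} g_M ⊕ ψ² g_N` on
`M × N`, for `0 < ψ ∈ C^∞(M)` and `μ ∈ ℝ`. -/
def sbcwp (g : PseudoRiemannianMetric I M) (h : PseudoRiemannianMetric J N) (ψ : M → ℝ) (μ : ℝ)
    (hψ : ContMDiff I 𝓘(ℝ, ℝ) ∞ ψ) (hψ₀ : ∀ x, 0 < ψ x) :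
    PseudoRiemannianMetric (I.prod J) (M × N) :=
  bcwp g h (fun x ↦ ψ x ^ μ) ψ (hψ.rpow_const_of_pos hψ₀ μ)
    (fun x ↦ Real.rpow_pos_of_pos (hψ₀ x) μ) hψ hψ₀

end WarpedProduct

end

/-! The conformal factor is absorbed into the base: with `c = ψ ^ μ` and `w = ψ`, the metric is an
ordinary warped product over the curve B with metric c² g_B. In a product chart it reads A(t) dt² +
w(t)² G(y). A direct computation of Christoffel symbols and curvature (`IsWarpedAt.ricci_eq_of_sq`,
made global in `ricci_bcwp`) gives Ric = Ric_F - k (Δw / w) A dt² - (w Δw + (k - 1) |dw|²) G, where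
Δ and |dw|² belong to A dt².

Mixed terms vanish, so the Einstein equation splits (`isEinstein_bcwp_iff`) into λ = -k Δw / w and ν
= λ w² + w Δw + (k - 1) |dw|². Eliminating λ gives ν = (k - 1)(|dw|² - w Δw). For k > 1 the left
side lives on F and the right side on B, so |dw|² - w Δw is a constant C. For k = 1, λ is a constant
L and Δw = -L w.

Either equation has a first integral, because d|dw|² = 2 Δw dw in dimension one
(`hasFDerivAt_curveGradSq`): |dw|² + L w² for k = 1, and (|dw|² - C) / w² for k > 1. By compactness
w has a maximum and a minimum, where dw = 0. Comparing the first integral there gives w_max = w_min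
if L or C is nonzero, and |dw|² = 0 everywhere otherwise (`const_of_curveLaplacian_eq_mul`,
`const_of_curveGradSq_sub_eq`). So w is constant, and the split equations then force λ = 0 and ν =
0. Conversely these values solve them. -/

noncomputable section

open ContinuousLinearMap

/-! ### Curvature in local coordinates -/

section Calculus

variable {D E F : Type*} [NormedAddCommGroup D] [NormedSpace ℝ D]
  [NormedAddCommGroup E] [NormedSpace ℝ E] [NormedAddCommGroup F] [NormedSpace ℝ F]

/-- A family of linear maps on a finite-dimensional space is differentiable if all its evaluations
are. -/
theorem differentiableAt_of_clm_apply [FiniteDimensional ℝ E] {f : D → E →L[ℝ] F} {x : D}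
    (h : ∀ v, DifferentiableAt ℝ (fun p => f p v) x) : DifferentiableAt ℝ f x := by
  let d := Module.finrank ℝ E
  have hd : d = Module.finrank ℝ (Fin d → ℝ) := (Module.finrank_fin_fun ℝ).symm
  let e₁ := ContinuousLinearEquiv.ofFinrankEq hd
  let e₂ := (e₁.arrowCongr (1 : F ≃L[ℝ] F)).trans (ContinuousLinearEquiv.piRing (Fin d))
  rw [← Function.id_comp f, ← e₂.symm_comp_self]
  exact e₂.symm.differentiableAt.comp x (differentiableAt_pi.mpr fun i => h _)

theorem fderiv_clm_apply_apply {f : D → E →L[ℝ] E →L[ℝ] F} {x : D} (hf : DifferentiableAt ℝ f x)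
    (r : D) (u v : E) : fderiv ℝ (fun p => f p u v) x r = fderiv ℝ f x r u v := by
  have h := (hf.hasFDerivAt.clm_apply (hasFDerivAt_const u x)).clm_apply (hasFDerivAt_const v x)
  rw [h.fderiv]
  simp

end Calculus

/-! ### Traces on lines, products and rank-one maps -/

section Trace

variable {X Y : Type*} [AddCommGroup X] [Module ℝ X] [AddCommGroup Y] [Module ℝ Y]

/-- Since L x = ε(x) L e, the map L factors through ℝ, and cyclicity of the trace reduces it to a
scalar. -/
theorem LinearMap.trace_eq_of_line [Module.Finite ℝ X] (e : X) (ε : X →ₗ[ℝ] ℝ)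
    (h : ∀ x, ε x • e = x) (L : X →ₗ[ℝ] X) : LinearMap.trace ℝ X L = ε (L e) := by
  have : L = (L ∘ₗ LinearMap.toSpanSingleton ℝ X e) ∘ₗ ε := by
    ext x
    simp [h]
  rw [this, LinearMap.trace_comp_comm']
  have h2 : ∀ φ : ℝ →ₗ[ℝ] ℝ, LinearMap.trace ℝ ℝ φ = φ 1 := by
    intro φ
    rw [LinearMap.trace_eq_matrix_trace ℝ (Module.Basis.singleton Unit ℝ)]
    simp [Matrix.trace, LinearMap.toMatrix_apply]
  rw [h2]
  simp [h]

theorem LinearMap.trace_prod_eq [Module.Finite ℝ X] [Module.Finite ℝ Y]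
    (L : X × Y →ₗ[ℝ] X × Y) :
    LinearMap.trace ℝ (X × Y) L =
      LinearMap.trace ℝ X (LinearMap.fst ℝ X Y ∘ₗ L ∘ₗ LinearMap.inl ℝ X Y) +
        LinearMap.trace ℝ Y (LinearMap.snd ℝ X Y ∘ₗ L ∘ₗ LinearMap.inr ℝ X Y) := by
  have : L = (L ∘ₗ LinearMap.inl ℝ X Y) ∘ₗ LinearMap.fst ℝ X Y +
      (L ∘ₗ LinearMap.inr ℝ X Y) ∘ₗ LinearMap.snd ℝ X Y := by
    apply LinearMap.ext
    rintro ⟨x, y⟩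
    simp [← map_add]
  conv_lhs => rw [this, map_add]
  congr 1
  · exact LinearMap.trace_comp_comm' (LinearMap.fst ℝ X Y) (L ∘ₗ LinearMap.inl ℝ X Y)
  · exact LinearMap.trace_comp_comm' (LinearMap.snd ℝ X Y) (L ∘ₗ LinearMap.inr ℝ X Y)

theorem LinearMap.trace_smulRight_eq [Module.Finite ℝ X] (φ : X →ₗ[ℝ] ℝ) (x : X) :
    LinearMap.trace ℝ X (φ.smulRight x) = φ x := by
  have : φ.smulRight x = LinearMap.toSpanSingleton ℝ X x ∘ₗ φ := by ext; simp
  rw [this, LinearMap.trace_comp_comm',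
    LinearMap.trace_eq_of_line (1 : ℝ) LinearMap.id (by simp)]
  simp

end Trace

/-! ### Christoffel symbols of a nondegenerate form -/

namespace LocalMetric

variable {E : Type*} [NormedAddCommGroup E] [NormedSpace ℝ E]

theorem fderiv_symm {g : E → E →L[ℝ] E →L[ℝ] ℝ} {y : E} (hd : DifferentiableAt ℝ g y)
    (hsymm : ∀ᶠ p in 𝓝 y, ∀ v w, g p v w = g p w v) (r u v : E) :
    fderiv ℝ g y r u v = fderiv ℝ g y r v u := by
  rw [← fderiv_clm_apply_apply hd, ← fderiv_clm_apply_apply hd]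
  congr 1
  exact Filter.EventuallyEq.fderiv_eq (hsymm.mono fun p hp => hp u v)

theorem christoffel_symm {g : E → E →L[ℝ] E →L[ℝ] ℝ} {y : E} (hd : DifferentiableAt ℝ g y)
    (hsymm : ∀ᶠ p in 𝓝 y, ∀ v w, g p v w = g p w v) (u v : E) :
    christoffel g y u v = christoffel g y v u := by
  rw [christoffel_apply, christoffel_apply]
  congr 1
  ext w
  rw [koszul_apply, koszul_apply, fderiv_symm hd hsymm w u v]
  ring

/-- The linear map `u ↦ R(u, v) w`. -/
def curvatureMap (g : E → E →L[ℝ] E →L[ℝ] ℝ) (y v w : E) : E →ₗ[ℝ] E where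
  toFun u := curvature g y u v w
  map_add' a b := by simp only [curvature, map_add, add_apply]; abel
  map_smul' c a := by
    simp only [curvature, map_smul, smul_apply, RingHom.id_apply, smul_sub, smul_add]

theorem ricci_eq_trace (g : E → E →L[ℝ] E →L[ℝ] ℝ) (y v w : E) :
    ricci g y v w = LinearMap.trace ℝ E (curvatureMap g y v w) := rfl

variable [FiniteDimensional ℝ E]

/-- `ContinuousLinearMap.inverse` is zero off the invertible maps, so `christoffel` has its meaning
only once nondegeneracy is upgraded to invertibility. In finite dimension, injectivity into a dual
of equal dimension suffices. -/
theorem exists_equiv_of_nondegenerate {b : E →L[ℝ] E →L[ℝ] ℝ}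
    (hb : ∀ v, (∀ w, b v w = 0) → v = 0) :
    ∃ φ : E ≃L[ℝ] (E →L[ℝ] ℝ), (φ : E →L[ℝ] E →L[ℝ] ℝ) = b := by
  have hfin : FiniteDimensional ℝ (E →L[ℝ] ℝ) :=
    Module.Finite.equiv (LinearMap.toContinuousLinearMap (𝕜 := ℝ) (E := E) (F' := ℝ))
  have hd : Module.finrank ℝ E = Module.finrank ℝ (E →L[ℝ] ℝ) := by
    rw [← (LinearMap.toContinuousLinearMap (𝕜 := ℝ) (E := E) (F' := ℝ)).finrank_eq]
    exact (Subspace.dual_finrank_eq (K := ℝ) (V := E)).symm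
  have hinj : Function.Injective (b : E →ₗ[ℝ] (E →L[ℝ] ℝ)) := by
    refine (injective_iff_map_eq_zero _).2 fun v hv => hb v fun w => ?_
    exact DFunLike.congr_fun hv w
  refine ⟨(LinearMap.linearEquivOfInjective _ hinj hd).toContinuousLinearEquiv, ?_⟩
  ext v w
  simp

theorem apply_christoffel {g : E → E →L[ℝ] E →L[ℝ] ℝ} {y : E}
    (hg : ∀ v, (∀ w, g y v w = 0) → v = 0) (u v : E) :
    g y (christoffel g y u v) = koszul g y u v := by
  obtain ⟨φ, hφ⟩ := exists_equiv_of_nondegenerate hg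
  rw [christoffel_apply, ← hφ, ContinuousLinearMap.inverse_equiv]
  simp

/-- Allows a formula for the Christoffel symbols to be guessed and then checked against the Koszul
formula, without inverting the metric. -/
theorem christoffel_eq_of_forall {g : E → E →L[ℝ] E →L[ℝ] ℝ} {y : E}
    (hg : ∀ v, (∀ w, g y v w = 0) → v = 0) {u v z : E}
    (h : ∀ w, g y z w = koszul g y u v w) : christoffel g y u v = z := by
  rw [← sub_eq_zero]
  refine hg _ fun w => ?_
  rw [map_sub, sub_apply, apply_christoffel hg, h, sub_self]

-- Inversion is smooth at invertible maps, so the only loss of regularity is the one derivative in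
-- `koszul`.
set_option synthInstance.maxHeartbeats 200000 in
theorem contDiffAt_christoffel {g : E → E →L[ℝ] E →L[ℝ] ℝ} {y : E} (hs : ContDiffAt ℝ 2 g y)
    (hg : ∀ v, (∀ w, g y v w = 0) → v = 0) : ContDiffAt ℝ 1 (christoffel g) y := by
  obtain ⟨φ, hφ⟩ := exists_equiv_of_nondegenerate hg
  have h1 : ContDiffAt ℝ 1 (fderiv ℝ g) y := hs.fderiv_right (by norm_num)
  have h2 : ContDiffAt ℝ 1 (fun y => (g y).inverse) y := by
    refine ContDiffAt.comp (g := ContinuousLinearMap.inverse) y ?_ (hs.of_le (by norm_num))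
    rw [← hφ]
    exact contDiffAt_map_inverse φ
  have h3 : ContDiffAt ℝ 1 (fun y => (fderiv ℝ g y).flip) y :=
    (flipₗᵢ ℝ E E (E →L[ℝ] ℝ)).contDiff.contDiffAt.comp y h1
  have h4 : ContDiffAt ℝ 1 (koszul g) y := by
    unfold koszul
    exact ((h1.add h3).sub (contDiffAt_const.clm_comp h3)).const_smul _
  have h5 : ContDiffAt ℝ 1 (fun y => (g y).inverse.postcomp E) y :=
    (compL ℝ E (E →L[ℝ] ℝ) E).contDiff.contDiffAt.comp y h2
  exact h5.clm_comp h4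

/-- Invertible maps form an open set. -/
theorem eventually_nondegenerate {g : E → E →L[ℝ] E →L[ℝ] ℝ} {y : E} (hs : ContinuousAt g y)
    (hg : ∀ v, (∀ w, g y v w = 0) → v = 0) :
    ∀ᶠ p in 𝓝 y, ∀ v, (∀ w, g p v w = 0) → v = 0 := by
  obtain ⟨φ, hφ⟩ := exists_equiv_of_nondegenerate hg
  have := hs.eventually (hφ ▸ ContinuousLinearEquiv.nhds φ)
  filter_upwards [this] with p hp v hv
  obtain ⟨χ, hχ⟩ := hp
  apply χ.injective
  ext w
  have := hv w
  rw [← hχ] at this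
  simpa using this

end LocalMetric

/-! ### Curvature of A(t) dt² + f(t) G(y) -/

namespace LocalMetric

variable {X Y : Type*} [NormedAddCommGroup X] [NormedSpace ℝ X]
  [NormedAddCommGroup Y] [NormedSpace ℝ Y]

/-- Near `p`, the form `g` on `X × Y` is the warped product `A(t) dt² + f(t) G(y)`, where `t` is the
coordinate `ε` of the line `X = ℝ e`. -/
structure IsWarpedAt (e : X) (ε : X →L[ℝ] ℝ) (A f : X → ℝ) (G : Y → Y →L[ℝ] Y →L[ℝ] ℝ)
    (g : X × Y → X × Y →L[ℝ] X × Y →L[ℝ] ℝ) (p : X × Y) : Prop where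
  eq : ∀ᶠ q in 𝓝 p, ∀ u v, g q u v = A q.1 * (ε u.1 * ε v.1) + f q.1 * G q.2 u.2 v.2
  smul_eq : ∀ x, ε x • e = x
  apply_eq : ε e = 1
  contDiffAt_base : ContDiffAt ℝ 2 A p.1
  contDiffAt_warp : ContDiffAt ℝ 2 f p.1
  contDiffAt_fiber : ContDiffAt ℝ 2 G p.2
  base_ne_zero : A p.1 ≠ 0
  warp_ne_zero : f p.1 ≠ 0
  symm : ∀ᶠ y in 𝓝 p.2, ∀ v w, G y v w = G y w v
  nondegenerate : ∀ v, (∀ w, G p.2 v w = 0) → v = 0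

/-- The function `f' / (2 a)`, with the derivative taken in the direction `e`. -/
def halfRatio (e : X) (f A : X → ℝ) (t : X) : ℝ := fderiv ℝ f t e / (2 * A t)

theorem differentiableAt_halfRatio (e : X) {f A : X → ℝ} {t : X} (hf : ContDiffAt ℝ 2 f t)
    (hA : ContDiffAt ℝ 2 A t) (h0 : A t ≠ 0) : DifferentiableAt ℝ (halfRatio e f A) t := by
  have h1 : DifferentiableAt ℝ (fun t => fderiv ℝ f t e) t :=
    ((hf.fderiv_right (m := 1) (by norm_num)).differentiableAt (by norm_num)).clm_apply
      (differentiableAt_const e)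
  have h2 : DifferentiableAt ℝ A t := hA.differentiableAt (by norm_num)
  unfold halfRatio
  fun_prop (disch := simpa using h0)

namespace IsWarpedAt

variable {e : X} {ε : X →L[ℝ] ℝ} {A f : X → ℝ} {G : Y → Y →L[ℝ] Y →L[ℝ] ℝ}
  {g : X × Y → X × Y →L[ℝ] X × Y →L[ℝ] ℝ} {p : X × Y}

theorem hasFDerivAt_apply (h : IsWarpedAt e ε A f G g p) (u v : X × Y) :
    HasFDerivAt (fun q => g q u v)
      ((ε u.1 * ε v.1) • (fderiv ℝ A p.1 ∘L fst ℝ X Y) +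
        (f p.1 • ((fderiv ℝ G p.2).flip u.2).flip v.2 ∘L snd ℝ X Y +
          (G p.2 u.2 v.2) • (fderiv ℝ f p.1 ∘L fst ℝ X Y))) p := by
  have hA : HasFDerivAt (fun q : X × Y => A q.1) (fderiv ℝ A p.1 ∘L fst ℝ X Y) p :=
    (h.contDiffAt_base.differentiableAt (by norm_num)).hasFDerivAt.comp p hasFDerivAt_fst
  have hf : HasFDerivAt (fun q : X × Y => f q.1) (fderiv ℝ f p.1 ∘L fst ℝ X Y) p :=
    (h.contDiffAt_warp.differentiableAt (by norm_num)).hasFDerivAt.comp p hasFDerivAt_fst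
  have hG : HasFDerivAt (fun q : X × Y => G q.2 u.2 v.2)
      (((fderiv ℝ G p.2).flip u.2).flip v.2 ∘L snd ℝ X Y) p := by
    have h0 : HasFDerivAt G (fderiv ℝ G p.2) p.2 :=
      (h.contDiffAt_fiber.differentiableAt (by norm_num)).hasFDerivAt
    have h1 := (h0.clm_apply (hasFDerivAt_const u.2 _)).clm_apply (hasFDerivAt_const v.2 _)
    refine (h1.comp p hasFDerivAt_snd).congr_fderiv ?_
    ext <;> simp
  have h2 := (hA.mul_const (ε u.1 * ε v.1)).add (hf.mul hG)
  exact h2.congr_of_eventuallyEq (h.eq.mono fun q hq => hq u v)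

theorem nondegenerate_apply (h : IsWarpedAt e ε A f G g p) (v : X × Y)
    (hv : ∀ w, g p v w = 0) : v = 0 := by
  have h0 := h.eq.self_of_nhds
  have h1 : v.1 = 0 := by
    have := hv (e, 0)
    rw [h0] at this
    rw [← h.smul_eq v.1]
    simpa [h.apply_eq, h.base_ne_zero] using Or.inl this
  have h2 : v.2 = 0 := by
    refine h.nondegenerate _ fun w => ?_
    have := hv (0, w)
    rw [h0] at this
    simpa [h.warp_ne_zero] using this
  exact Prod.ext h1 h2

variable [FiniteDimensional ℝ Y]

/-- Curvature differentiates the Christoffel symbols, so their formula is needed on a neighbourhood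
and not only at p. -/
theorem eventually (h : IsWarpedAt e ε A f G g p) : ∀ᶠ q in 𝓝 p, IsWarpedAt e ε A f G g q := by
  have h1 : Filter.Tendsto Prod.fst (𝓝 p) (𝓝 p.1) := continuous_fst.continuousAt
  have h2 : Filter.Tendsto Prod.snd (𝓝 p) (𝓝 p.2) := continuous_snd.continuousAt
  filter_upwards [h.eq.eventually_nhds,
    h1.eventually (h.contDiffAt_base.eventually (by simp)),
    h1.eventually (h.contDiffAt_warp.eventually (by simp)),
    h2.eventually (h.contDiffAt_fiber.eventually (by simp)),
    h1.eventually (h.contDiffAt_base.continuousAt.eventually_ne h.base_ne_zero),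
    h1.eventually (h.contDiffAt_warp.continuousAt.eventually_ne h.warp_ne_zero),
    h2.eventually h.symm.eventually_nhds,
    h2.eventually (eventually_nondegenerate h.contDiffAt_fiber.continuousAt h.nondegenerate)]
    with q a1 a2 a3 a4 a5 a6 a7 a8
  exact ⟨a1, h.smul_eq, h.apply_eq, a2, a3, a4, a5, a6, a7, a8⟩

variable [FiniteDimensional ℝ X]

theorem differentiableAt (h : IsWarpedAt e ε A f G g p) : DifferentiableAt ℝ g p :=
  differentiableAt_of_clm_apply fun u => differentiableAt_of_clm_apply fun v =>
    (h.hasFDerivAt_apply u v).differentiableAt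

theorem fderiv_apply (h : IsWarpedAt e ε A f G g p) (r u v : X × Y) :
    fderiv ℝ g p r u v = ε r.1 * fderiv ℝ A p.1 e * (ε u.1 * ε v.1) +
      (f p.1 * fderiv ℝ G p.2 r.2 u.2 v.2 + ε r.1 * fderiv ℝ f p.1 e * G p.2 u.2 v.2) := by
  rw [← fderiv_clm_apply_apply h.differentiableAt, (h.hasFDerivAt_apply u v).fderiv]
  have hr : ∀ L : X →L[ℝ] ℝ, L r.1 = ε r.1 * L e := fun L => by
    conv_lhs => rw [← h.smul_eq r.1, map_smul, smul_eq_mul]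
  simp [hr (fderiv ℝ A p.1), hr (fderiv ℝ f p.1)]
  ring

/-- The three coefficients are A'/2A, f'/2A and f'/2f; pairing the proposed vector with an arbitrary
w reproduces the Koszul formula. -/
theorem christoffel_eq (h : IsWarpedAt e ε A f G g p) (u v : X × Y) :
    christoffel g p u v =
      ((halfRatio e A A p.1 * (ε u.1 * ε v.1) - halfRatio e f A p.1 * G p.2 u.2 v.2) • e,
        christoffel G p.2 u.2 v.2 + halfRatio e f f p.1 • (ε u.1 • v.2 + ε v.1 • u.2)) := by
  refine christoffel_eq_of_forall h.nondegenerate_apply fun w => ?_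
  rw [h.eq.self_of_nhds, koszul_apply, h.fderiv_apply, h.fderiv_apply, h.fderiv_apply]
  simp only [map_add, map_smul, add_apply, smul_apply, smul_eq_mul, h.apply_eq,
    apply_christoffel h.nondegenerate, koszul_apply]
  rw [halfRatio, halfRatio, halfRatio]
  have := h.base_ne_zero
  have := h.warp_ne_zero
  field_simp
  ring

theorem hasFDerivAt_christoffel (h : IsWarpedAt e ε A f G g p) (v w : X × Y) :
    HasFDerivAt (fun q => christoffel g q v w)
      ((((ε v.1 * ε w.1) • (fderiv ℝ (halfRatio e A A) p.1 ∘L fst ℝ X Y) -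
        (halfRatio e f A p.1 • ((fderiv ℝ G p.2).flip v.2).flip w.2 ∘L snd ℝ X Y +
          (G p.2 v.2 w.2) • (fderiv ℝ (halfRatio e f A) p.1 ∘L fst ℝ X Y))).smulRight e).prod
        (((fderiv ℝ (christoffel G) p.2).flip v.2).flip w.2 ∘L snd ℝ X Y +
          (fderiv ℝ (halfRatio e f f) p.1 ∘L fst ℝ X Y).smulRight
            (ε v.1 • w.2 + ε w.1 • v.2))) p := by
  have hα : HasFDerivAt (fun q : X × Y => halfRatio e A A q.1)
      (fderiv ℝ (halfRatio e A A) p.1 ∘L fst ℝ X Y) p :=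
    (differentiableAt_halfRatio e h.contDiffAt_base h.contDiffAt_base
      h.base_ne_zero).hasFDerivAt.comp p hasFDerivAt_fst
  have hβ : HasFDerivAt (fun q : X × Y => halfRatio e f A q.1)
      (fderiv ℝ (halfRatio e f A) p.1 ∘L fst ℝ X Y) p :=
    (differentiableAt_halfRatio e h.contDiffAt_warp h.contDiffAt_base
      h.base_ne_zero).hasFDerivAt.comp p hasFDerivAt_fst
  have hγ : HasFDerivAt (fun q : X × Y => halfRatio e f f q.1)
      (fderiv ℝ (halfRatio e f f) p.1 ∘L fst ℝ X Y) p :=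
    (differentiableAt_halfRatio e h.contDiffAt_warp h.contDiffAt_warp
      h.warp_ne_zero).hasFDerivAt.comp p hasFDerivAt_fst
  have hG : HasFDerivAt (fun q : X × Y => G q.2 v.2 w.2)
      (((fderiv ℝ G p.2).flip v.2).flip w.2 ∘L snd ℝ X Y) p := by
    have h0 : HasFDerivAt G (fderiv ℝ G p.2) p.2 :=
      (h.contDiffAt_fiber.differentiableAt (by norm_num)).hasFDerivAt
    have h1 := (h0.clm_apply (hasFDerivAt_const v.2 _)).clm_apply (hasFDerivAt_const w.2 _)
    refine (h1.comp p hasFDerivAt_snd).congr_fderiv ?_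
    ext <;> simp
  have hΓ : HasFDerivAt (fun q : X × Y => christoffel G q.2 v.2 w.2)
      (((fderiv ℝ (christoffel G) p.2).flip v.2).flip w.2 ∘L snd ℝ X Y) p := by
    have h0 : HasFDerivAt (christoffel G) (fderiv ℝ (christoffel G) p.2) p.2 :=
      ((contDiffAt_christoffel h.contDiffAt_fiber h.nondegenerate).differentiableAt
        (by norm_num)).hasFDerivAt
    have h1 := (h0.clm_apply (hasFDerivAt_const v.2 _)).clm_apply (hasFDerivAt_const w.2 _)
    refine (h1.comp p hasFDerivAt_snd).congr_fderiv ?_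
    ext <;> simp
  have h1 := ((hα.mul_const (ε v.1 * ε w.1)).sub (hβ.mul hG)).smul_const e
  have h2 := hΓ.add (hγ.smul_const (ε v.1 • w.2 + ε w.1 • v.2))
  exact (h1.prodMk h2).congr_of_eventuallyEq (h.eventually.mono fun q hq => hq.christoffel_eq v w)

theorem fderiv_christoffel (h : IsWarpedAt e ε A f G g p) (u v w : X × Y) :
    fderiv ℝ (christoffel g) p u v w =
      ((ε v.1 * ε w.1 * (ε u.1 * fderiv ℝ (halfRatio e A A) p.1 e) -
        (halfRatio e f A p.1 * fderiv ℝ G p.2 u.2 v.2 w.2 +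
          G p.2 v.2 w.2 * (ε u.1 * fderiv ℝ (halfRatio e f A) p.1 e))) • e,
        fderiv ℝ (christoffel G) p.2 u.2 v.2 w.2 +
          (ε u.1 * fderiv ℝ (halfRatio e f f) p.1 e) • (ε v.1 • w.2 + ε w.1 • v.2)) := by
  have hd : DifferentiableAt ℝ (christoffel g) p :=
    differentiableAt_of_clm_apply fun u => differentiableAt_of_clm_apply fun v =>
      (h.hasFDerivAt_christoffel u v).differentiableAt
  have hr : ∀ L : X →L[ℝ] ℝ, L u.1 = ε u.1 * L e := fun L => by
    conv_lhs => rw [← h.smul_eq u.1, map_smul, smul_eq_mul]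
  rw [← fderiv_clm_apply_apply hd, (h.hasFDerivAt_christoffel v w).fderiv]
  simp [hr (fderiv ℝ (halfRatio e A A) p.1), hr (fderiv ℝ (halfRatio e f A) p.1),
    hr (fderiv ℝ (halfRatio e f f) p.1)]

theorem curvature_base (h : IsWarpedAt e ε A f G g p) (v w : X × Y) :
    ε (curvature g p (e, 0) v w).1 =
      (-fderiv ℝ (halfRatio e f A) p.1 e - halfRatio e A A p.1 * halfRatio e f A p.1 +
        halfRatio e f A p.1 * halfRatio e f f p.1) * G p.2 v.2 w.2 := by
  simp only [curvature, h.fderiv_christoffel, h.christoffel_eq]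
  simp [h.apply_eq]
  ring

theorem curvature_fiber (h : IsWarpedAt e ε A f G g p) (x : Y) (v w : X × Y) :
    (curvature g p (0, x) v w).2 = curvature G p.2 x v.2 w.2 +
      ((-fderiv ℝ (halfRatio e f f) p.1 e + halfRatio e A A p.1 * halfRatio e f f p.1 -
        halfRatio e f f p.1 ^ 2) * (ε v.1 * ε w.1) -
        halfRatio e f f p.1 * halfRatio e f A p.1 * G p.2 v.2 w.2) • x +
      (halfRatio e f f p.1 * halfRatio e f A p.1 * G p.2 x w.2) • v.2 := by
  simp only [curvature, h.fderiv_christoffel, h.christoffel_eq]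
  simp [h.apply_eq,
    christoffel_symm (h.contDiffAt_fiber.differentiableAt (by norm_num)) h.symm v.2 x]
  module

/-- The Ricci curvature of the warped product `A(t) dt² + f(t) G(y)`. -/
theorem ricci_eq (h : IsWarpedAt e ε A f G g p) (v w : X × Y) :
    ricci g p v w = ricci G p.2 v.2 w.2 +
      Module.finrank ℝ Y * (-fderiv ℝ (halfRatio e f f) p.1 e +
        halfRatio e A A p.1 * halfRatio e f f p.1 - halfRatio e f f p.1 ^ 2) * (ε v.1 * ε w.1) +
      (-fderiv ℝ (halfRatio e f A) p.1 e - halfRatio e A A p.1 * halfRatio e f A p.1 +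
        halfRatio e f A p.1 * halfRatio e f f p.1 -
        (Module.finrank ℝ Y - 1) * (halfRatio e f f p.1 * halfRatio e f A p.1)) *
          G p.2 v.2 w.2 := by
  set a := (-fderiv ℝ (halfRatio e f f) p.1 e + halfRatio e A A p.1 * halfRatio e f f p.1 -
        halfRatio e f f p.1 ^ 2) * (ε v.1 * ε w.1) -
        halfRatio e f f p.1 * halfRatio e f A p.1 * G p.2 v.2 w.2
  -- The fibre block is the fibre curvature, plus a multiple of the identity, plus a rank-one map.
  -- The last two contribute -k and +1 times the same product of half ratios with G, whence the
  -- factor k - 1.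
  have hY : LinearMap.snd ℝ X Y ∘ₗ curvatureMap g p v w ∘ₗ LinearMap.inr ℝ X Y =
      curvatureMap G p.2 v.2 w.2 + a • LinearMap.id +
        (halfRatio e f f p.1 * halfRatio e f A p.1) •
          ((G p.2).flip w.2 : Y →ₗ[ℝ] ℝ).smulRight v.2 := by
    ext x
    simp [curvatureMap, h.curvature_fiber, smul_smul, a]
  rw [ricci_eq_trace, LinearMap.trace_prod_eq,
    LinearMap.trace_eq_of_line e (ε : X →ₗ[ℝ] ℝ) h.smul_eq, hY, map_add, map_add, map_smul,
    map_smul, LinearMap.trace_smulRight_eq, LinearMap.trace_id, ricci_eq_trace]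
  have hX := h.curvature_base v w
  simp only [LinearMap.coe_comp, Function.comp_apply, LinearMap.inl_apply, LinearMap.fst_apply,
    curvatureMap, LinearMap.coe_mk, AddHom.coe_mk, ContinuousLinearMap.coe_coe, hX, flip_apply,
    smul_eq_mul, a]
  ring

end IsWarpedAt

end LocalMetric

/-! ### Gradient and Laplacian on a line -/

namespace LocalMetric

variable {X Y : Type*} [NormedAddCommGroup X] [NormedSpace ℝ X]
  [NormedAddCommGroup Y] [NormedSpace ℝ Y]

/-- The squared length of the differential of `w`, for the metric `A dt²` on the line `ℝ e`. -/
def lineGradSq (e : X) (w A : X → ℝ) (t : X) : ℝ := fderiv ℝ w t e ^ 2 / A t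

/-- The Laplacian of `w`, for the metric `A dt²` on the line `ℝ e`. -/
def lineLaplacian (e : X) (w A : X → ℝ) (t : X) : ℝ :=
  fderiv ℝ (fun s => fderiv ℝ w s e) t e / A t -
    fderiv ℝ A t e * fderiv ℝ w t e / (2 * A t ^ 2)

section Line

variable {e : X} {w A : X → ℝ} {t : X}

theorem differentiableAt_fderiv_apply (hw : ContDiffAt ℝ 2 w t) :
    DifferentiableAt ℝ (fun s => fderiv ℝ w s e) t :=
  ((hw.fderiv_right (m := 1) (by norm_num)).differentiableAt (by norm_num)).clm_apply
    (differentiableAt_const e)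

theorem fderiv_sq_apply (hw : DifferentiableAt ℝ w t) :
    fderiv ℝ (fun s => w s ^ 2) t e = 2 * w t * fderiv ℝ w t e := by
  rw [(hw.hasFDerivAt.pow 2).fderiv]
  simp

theorem fderiv_div_apply {a b : X → ℝ} (ha : DifferentiableAt ℝ a t) (hb : DifferentiableAt ℝ b t)
    (h0 : b t ≠ 0) : fderiv ℝ (fun s => a s / b s) t e =
      (fderiv ℝ a t e * b t - a t * fderiv ℝ b t e) / b t ^ 2 := by
  have h1 : HasDerivAt (fun x : ℝ => x⁻¹) (-(b t ^ 2)⁻¹) (b t) := hasDerivAt_inv h0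
  have h2 := ha.hasFDerivAt.fun_mul (h1.comp_hasFDerivAt t hb.hasFDerivAt)
  have h3 : (fun s => a s / b s) = fun s => a s * ((fun x : ℝ => x⁻¹) ∘ b) s := by
    ext s
    simp [div_eq_mul_inv]
  rw [h3, h2.fderiv]
  simp
  field_simp
  ring

/-- In dimension one the Hessian is determined by its trace, so d|dw|² = 2 Hess w(∇w, ·) becomes 2
Δw dw. This identity is the source of both first integrals. -/
theorem fderiv_lineGradSq (hw : ContDiffAt ℝ 2 w t) (hA : ContDiffAt ℝ 2 A t) (h0 : A t ≠ 0) :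
    fderiv ℝ (lineGradSq e w A) t e = 2 * lineLaplacian e w A t * fderiv ℝ w t e := by
  have h1 := differentiableAt_fderiv_apply (e := e) hw
  unfold lineGradSq lineLaplacian
  rw [fderiv_div_apply (h1.fun_pow 2) (hA.differentiableAt (by norm_num)) h0, fderiv_sq_apply h1]
  field_simp

theorem halfRatio_sq_self (hw : ContDiffAt ℝ 2 w t) (h0 : w t ≠ 0) :
    halfRatio e (fun s => w s ^ 2) (fun s => w s ^ 2) t = fderiv ℝ w t e / w t := by
  rw [halfRatio, fderiv_sq_apply (hw.differentiableAt (by norm_num))]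
  field_simp

theorem halfRatio_sq (hw : ContDiffAt ℝ 2 w t) :
    halfRatio e (fun s => w s ^ 2) A t = w t * fderiv ℝ w t e / A t := by
  rw [halfRatio, fderiv_sq_apply (hw.differentiableAt (by norm_num)), mul_assoc,
    mul_div_mul_left _ _ (by norm_num)]

theorem fderiv_halfRatio_sq_self (hw : ContDiffAt ℝ 2 w t) (h0 : w t ≠ 0) :
    fderiv ℝ (halfRatio e (fun s => w s ^ 2) (fun s => w s ^ 2)) t e =
      (fderiv ℝ (fun s => fderiv ℝ w s e) t e * w t - fderiv ℝ w t e ^ 2) / w t ^ 2 := by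
  have : halfRatio e (fun s => w s ^ 2) (fun s => w s ^ 2) =ᶠ[𝓝 t]
      fun s => fderiv ℝ w s e / w s := by
    filter_upwards [hw.eventually (by simp), hw.continuousAt.eventually_ne h0] with s h1 h2
    exact halfRatio_sq_self h1 h2
  rw [this.fderiv_eq, fderiv_div_apply (differentiableAt_fderiv_apply hw)
    (hw.differentiableAt (by norm_num)) h0]
  ring

theorem fderiv_halfRatio_sq (hw : ContDiffAt ℝ 2 w t) (hA : ContDiffAt ℝ 2 A t) (h0 : A t ≠ 0) :
    fderiv ℝ (halfRatio e (fun s => w s ^ 2) A) t e =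
      ((w t * fderiv ℝ (fun s => fderiv ℝ w s e) t e + fderiv ℝ w t e ^ 2) * A t -
        w t * fderiv ℝ w t e * fderiv ℝ A t e) / A t ^ 2 := by
  have : halfRatio e (fun s => w s ^ 2) A =ᶠ[𝓝 t] fun s => w s * fderiv ℝ w s e / A s := by
    filter_upwards [hw.eventually (by simp)] with s h1
    exact halfRatio_sq h1
  have h1 := differentiableAt_fderiv_apply (e := e) hw
  have h2 : DifferentiableAt ℝ w t := hw.differentiableAt (by norm_num)
  rw [this.fderiv_eq, fderiv_div_apply (h2.fun_mul h1) (hA.differentiableAt (by norm_num)) h0,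
    fderiv_fun_mul h2 h1]
  simp
  ring

end Line

/-- The Ricci curvature of the warped product `A(t) dt² + w(t)² G(y)`. -/
theorem IsWarpedAt.ricci_eq_of_sq [FiniteDimensional ℝ X] [FiniteDimensional ℝ Y]
    {e : X} {ε : X →L[ℝ] ℝ} {A w : X → ℝ} {G : Y → Y →L[ℝ] Y →L[ℝ] ℝ}
    {g : X × Y → X × Y →L[ℝ] X × Y →L[ℝ] ℝ} {p : X × Y}
    (h : IsWarpedAt e ε A (fun t => w t ^ 2) G g p) (hw : ContDiffAt ℝ 2 w p.1) (u v : X × Y) :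
    ricci g p u v = ricci G p.2 u.2 v.2 -
      Module.finrank ℝ Y * (lineLaplacian e w A p.1 / w p.1) * (A p.1 * (ε u.1 * ε v.1)) -
      (w p.1 * lineLaplacian e w A p.1 + (Module.finrank ℝ Y - 1) * lineGradSq e w A p.1) *
        G p.2 u.2 v.2 := by
  have hw0 : w p.1 ≠ 0 := by simpa using h.warp_ne_zero
  have hA0 := h.base_ne_zero
  rw [h.ricci_eq, fderiv_halfRatio_sq_self hw hw0, fderiv_halfRatio_sq hw h.contDiffAt_base hA0,
    halfRatio_sq_self hw hw0, halfRatio_sq hw, lineLaplacian, lineGradSq, halfRatio]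
  field_simp
  ring

end LocalMetric

/-! ### Functions with vanishing derivative -/

section Constant

variable {E : Type*} [NormedAddCommGroup E] [NormedSpace ℝ E]
  {H : Type*} [TopologicalSpace H] {I : ModelWithCorners ℝ E H}
  {M : Type*} [TopologicalSpace M] [ChartedSpace H M] [IsManifold I ∞ M]

/-- Derivatives are computed at each point in the chart centred there, while local constancy needs
all points of a single chart. The intrinsic derivative mediates between the two. -/
theorem hasMFDerivAt_zero_of_chart {Q : M → ℝ} {x : M}
    (h : HasFDerivAt (Q ∘ (extChartAt I x).symm) (0 : E →L[ℝ] ℝ) (extChartAt I x x)) :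
    HasMFDerivAt I 𝓘(ℝ, ℝ) Q x (0 : E →L[ℝ] ℝ) := by
  have : IsManifold I 1 M := .of_le (n := ∞) (by simp)
  have h1 := h.hasMFDerivAt.comp x
    (mdifferentiableAt_extChartAt (I := I) (mem_chart_source H x)).hasMFDerivAt
  have h2 : HasMFDerivAt I 𝓘(ℝ, ℝ) ((Q ∘ (extChartAt I x).symm) ∘ extChartAt I x) x
      (0 : E →L[ℝ] ℝ) := by
    exact ⟨h1.1, h1.2.congr_fderiv (ContinuousLinearMap.zero_comp _)⟩
  refine h2.congr_of_eventuallyEq ?_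
  filter_upwards [extChartAt_source_mem_nhds (I := I) x] with y hy
  simp only [Function.comp_apply, (extChartAt I x).left_inv hy]

variable [I.Boundaryless]

theorem isLocallyConstant_of_hasMFDerivAt_zero {Q : M → ℝ}
    (h : ∀ x, HasMFDerivAt I 𝓘(ℝ, ℝ) Q x (0 : E →L[ℝ] ℝ)) : IsLocallyConstant Q := by
  have : IsManifold I 1 M := .of_le (n := ∞) (by simp)
  intro s
  refine isOpen_iff_mem_nhds.2 fun x hx => ?_
  have hQ : ∀ t ∈ (extChartAt I x).target,
      HasFDerivAt (Q ∘ (extChartAt I x).symm) (0 : E →L[ℝ] ℝ) t := by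
    intro t ht
    have hs : MDifferentiableAt 𝓘(ℝ, E) I (extChartAt I x).symm t :=
      ((contMDiffOn_extChartAt_symm (n := 1) x).contMDiffAt
        ((isOpen_extChartAt_target x).mem_nhds ht)).mdifferentiableAt (by simp)
    have h1 := (h ((extChartAt I x).symm t)).comp t hs.hasMFDerivAt
    have h2 : HasMFDerivAt 𝓘(ℝ, E) 𝓘(ℝ, ℝ) (Q ∘ (extChartAt I x).symm) t (0 : E →L[ℝ] ℝ) :=
      ⟨h1.1, h1.2.congr_fderiv (ContinuousLinearMap.zero_comp _)⟩
    exact h2.hasFDerivAt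
  have ho := (isOpen_extChartAt_target (I := I) x).isOpen_inter_preimage_of_fderiv_eq_zero
    (fun t ht => (hQ t ht).differentiableAt.differentiableWithinAt)
    (fun t ht => (hQ t ht).fderiv) s
  have hmem : extChartAt I x x ∈ (extChartAt I x).target ∩ (Q ∘ (extChartAt I x).symm) ⁻¹' s :=
    ⟨mem_extChartAt_target x, by simpa using hx⟩
  filter_upwards [(continuousAt_extChartAt (I := I) x).preimage_mem_nhds (ho.mem_nhds hmem),
    extChartAt_source_mem_nhds (I := I) x] with y hy hys
  have := hy.2
  simpa only [Set.mem_preimage, Function.comp_apply, (extChartAt I x).left_inv hys] using this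

end Constant

/-! ### Metrics in charts -/

namespace PseudoRiemannianMetric

section Chart

variable {E : Type*} [NormedAddCommGroup E] [NormedSpace ℝ E]
  {H : Type*} [TopologicalSpace H] {I : ModelWithCorners ℝ E H}
  {M : Type*} [TopologicalSpace M] [ChartedSpace H M] [IsManifold I ∞ M]

theorem inChart_apply (g : PseudoRiemannianMetric I M) (x : M) (y u v : E) :
    g.inChart x y u v = g.val ((extChartAt I x).symm y)
      (mfderiv 𝓘(ℝ, E) I (extChartAt I x).symm y u)
      (mfderiv 𝓘(ℝ, E) I (extChartAt I x).symm y v) := rfl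

theorem inChart_symm (g : PseudoRiemannianMetric I M) (x : M) (y u v : E) :
    g.inChart x y u v = g.inChart x y v u := g.symm _ _ _

/-- The Ricci curvature in the chart at the base point. -/
theorem ricci_eq_inChart (g : PseudoRiemannianMetric I M) (x : M) (u v : TangentSpace I x) :
    g.ricci x u v = LocalMetric.ricci (g.inChart x) (extChartAt I x x) u v := by
  have : IsManifold I 1 M := .of_le (n := ∞) (by simp)
  rw [ricci, mfderiv_extChartAt_self]
  rfl

variable [I.Boundaryless]

theorem mfderiv_extChartAt_symm_self_apply (x : M) (u : E) :
    mfderiv 𝓘(ℝ, E) I (extChartAt I x).symm (extChartAt I x x) u = u := by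
  have : IsManifold I 1 M := .of_le (n := ∞) (by simp)
  have h := mfderivWithin_range_extChartAt_symm (I := I) (x := x)
  rw [I.range_eq_univ, mfderivWithin_univ] at h
  rw [h]
  rfl

theorem inChart_self (g : PseudoRiemannianMetric I M) (x : M) (u v : E) :
    g.inChart x (extChartAt I x x) u v = g.val x u v := by
  rw [inChart_apply, mfderiv_extChartAt_symm_self_apply, mfderiv_extChartAt_symm_self_apply,
    extChartAt_to_inv]

theorem inChart_nondegenerate (g : PseudoRiemannianMetric I M) (x : M) (u : E)
    (hu : ∀ v, g.inChart x (extChartAt I x x) u v = 0) : u = 0 :=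
  g.nondegenerate x u fun v => (g.inChart_self x u v).symm.trans (hu v)

/-- Smoothness of the metric is stated through the trivialization of the tangent bundle at x, whose
inverse on fibres is the derivative of the inverse chart. The coordinates are therefore those of
`inChart`. -/
theorem contDiffAt_inChart (g : PseudoRiemannianMetric I M) (x : M) :
    ContDiffAt ℝ ∞ (g.inChart x) (extChartAt I x x) := by
  have : IsManifold I 1 M := .of_le (n := ∞) (by simp)
  have hG := g.contMDiff x
  rw [contMDiffAt_hom_bundle] at hG
  have hs : ContMDiffAt 𝓘(ℝ, E) I ∞ (extChartAt I x).symm (extChartAt I x x) :=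
    (contMDiffOn_extChartAt_symm x).contMDiffAt (extChartAt_target_mem_nhds x)
  have h2 := hG.2
  rw [← extChartAt_to_inv (I := I) x] at h2
  have h3 := h2.comp (extChartAt I x x) hs
  rw [extChartAt_to_inv (I := I) x, contMDiffAt_iff_contDiffAt] at h3
  refine h3.congr_of_eventuallyEq ?_
  filter_upwards [extChartAt_target_mem_nhds (I := I) x] with y hy
  ext u v
  have hsrc : (extChartAt I x).symm y ∈ (chartAt H x).source := by
    rw [← extChartAt_source I]
    exact (extChartAt I x).map_target hy
  have hz : (extChartAt I x).symm y ∈ (trivializationAt E (TangentSpace I) x).baseSet := by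
    simpa using hsrc
  rw [inChart_apply]
  dsimp only [Function.comp]
  rw [inCoordinates_apply_eq₂ hz hz (Set.mem_univ _)]
  have hm : ∀ a : E, (trivializationAt E (TangentSpace I) x).symm ((extChartAt I x).symm y) a =
      mfderiv 𝓘(ℝ, E) I (extChartAt I x).symm y a := by
    intro a
    have h := TangentBundle.symmL_trivializationAt (I := I) hsrc
    rw [I.range_eq_univ, mfderivWithin_univ, (extChartAt I x).right_inv hy] at h
    rw [← Trivialization.symmL_apply (R := ℝ) (trivializationAt E (TangentSpace I) x) hz, h]
    rfl
  rw [hm, hm]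
  simp [Bundle.Trivial.linearMapAt_trivialization]

end Chart

end PseudoRiemannianMetric

/-! ### Warped products over a line -/

theorem two_le_infty : (2 : WithTop ℕ∞) ≤ ∞ :=
  WithTop.coe_le_coe.2 (le_top : (2 : ℕ∞) ≤ ⊤)

section Warped

variable {X : Type*} [NormedAddCommGroup X] [NormedSpace ℝ X]
  {H : Type*} [TopologicalSpace H] {I : ModelWithCorners ℝ X H}
  {B : Type*} [TopologicalSpace B] [ChartedSpace H B] [IsManifold I ∞ B]
  {Y : Type*} [NormedAddCommGroup Y] [NormedSpace ℝ Y]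
  {H' : Type*} [TopologicalSpace H'] {J : ModelWithCorners ℝ Y H'}
  {F : Type*} [TopologicalSpace F] [ChartedSpace H' F] [IsManifold J ∞ F]

theorem bcwp_val_apply (gB : PseudoRiemannianMetric I B) (gF : PseudoRiemannianMetric J F)
    (c w : B → ℝ) (hc : ContMDiff I 𝓘(ℝ, ℝ) ∞ c) (hc₀ : ∀ x, 0 < c x)
    (hw : ContMDiff I 𝓘(ℝ, ℝ) ∞ w) (hw₀ : ∀ x, 0 < w x) (z : B × F)
    (u v : TangentSpace (I.prod J) z) :
    (bcwp gB gF c w hc hc₀ hw hw₀).val z u v =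
      c z.1 ^ 2 * gB.val z.1 u.1 v.1 + w z.1 ^ 2 * gF.val z.2 u.2 v.2 := by
  change c z.1 ^ 2 * gB.val z.1 (mfderiv (I.prod J) I Prod.fst z u)
            (mfderiv (I.prod J) I Prod.fst z v) +
          w z.1 ^ 2 * gF.val z.2 (mfderiv (I.prod J) J Prod.snd z u)
            (mfderiv (I.prod J) J Prod.snd z v) = _
  simp only [mfderiv_fst, mfderiv_snd]
  rfl

/-- The coefficient `A` of the metric `c² g = A dt²` in the chart at `b`. -/
def baseCoeff (e : X) (g : PseudoRiemannianMetric I B) (c : B → ℝ) (b : B) (t : X) : ℝ :=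
  c ((extChartAt I b).symm t) ^ 2 * g.inChart b t e e

/-- The Laplacian of `w` at `b` for the metric `c² g` on a curve. -/
def curveLaplacian (e : X) (g : PseudoRiemannianMetric I B) (c w : B → ℝ) (b : B) : ℝ :=
  LocalMetric.lineLaplacian e (w ∘ (extChartAt I b).symm) (baseCoeff e g c b) (extChartAt I b b)

/-- The squared length of the differential of `w` at `b` for the metric `c² g` on a curve. -/
def curveGradSq (e : X) (g : PseudoRiemannianMetric I B) (c w : B → ℝ) (b : B) : ℝ :=
  LocalMetric.lineGradSq e (w ∘ (extChartAt I b).symm) (baseCoeff e g c b) (extChartAt I b b)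

theorem inChart_eq_of_line {e : X} {ε : X →L[ℝ] ℝ} (he : ∀ x, ε x • e = x)
    (g : PseudoRiemannianMetric I B) (b : B)
    (t u v : X) : g.inChart b t u v = ε u * ε v * g.inChart b t e e := by
  conv_lhs => rw [← he u, ← he v]
  simp
  ring

theorem val_eq_of_line {e : X} {ε : X →L[ℝ] ℝ} (he : ∀ x, ε x • e = x)
    (g : PseudoRiemannianMetric I B) (b : B) (u v : X) :
    g.val b u v = ε u * ε v * g.val b e e := by
  have key : ∀ β : X →L[ℝ] X →L[ℝ] ℝ, β u v = ε u * ε v * β e e := fun β => by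
    conv_lhs => rw [← he u, ← he v]
    simp
    ring
  exact key (g.val b)

theorem curveGradSq_eq_zero_of_isExtr (e : X) (g : PseudoRiemannianMetric I B) (c : B → ℝ)
    {w : B → ℝ} {b : B} (hb : IsExtrOn w Set.univ b) :
    curveGradSq e g c w b = 0 := by
  -- The extremum is global, so the inequality holds for every t, including points outside the chart
  -- target.
  have hext : IsLocalExtr (w ∘ (extChartAt I b).symm) (extChartAt I b b) := by
    rcases hb with hb | hb
    · exact Or.inl (Filter.Eventually.of_forall fun t => by
        simpa only [Function.comp_apply, extChartAt_to_inv, Set.mem_ofPred_eq] using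
          hb (Set.mem_univ _))
    · exact Or.inr (Filter.Eventually.of_forall fun t => by
        simpa only [Function.comp_apply, extChartAt_to_inv, Set.mem_ofPred_eq] using
          hb (Set.mem_univ _))
  rw [curveGradSq, LocalMetric.lineGradSq, hext.fderiv_eq_zero]
  simp

theorem val_ne_zero_of_line {e : X} {ε : X →L[ℝ] ℝ} (he : ∀ x, ε x • e = x) (hε : ε e = 1)
    (g : PseudoRiemannianMetric I B) (b : B) : g.val b e e ≠ 0 := by
  intro h
  have : e = 0 := g.nondegenerate b e fun v => by
    rw [val_eq_of_line he g b e v, h, mul_zero]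
  simp [this] at hε

variable [I.Boundaryless] [J.Boundaryless]

theorem hasMFDerivAt_extChartAt_symm {x : B} {t : X} (ht : t ∈ (extChartAt I x).target) :
    HasMFDerivAt 𝓘(ℝ, X) I (extChartAt I x).symm t
      (mfderiv 𝓘(ℝ, X) I (extChartAt I x).symm t) := by
  have : IsManifold I 1 B := .of_le (n := ∞) (by simp)
  exact (((contMDiffOn_extChartAt_symm (n := 1) x).contMDiffAt
        ((isOpen_extChartAt_target x).mem_nhds ht)).mdifferentiableAt (by simp)).hasMFDerivAt

theorem mfderiv_extChartAt_symm_prod_apply (z : B × F) {q : X × Y}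
    (h1 : q.1 ∈ (extChartAt I z.1).target) (h2 : q.2 ∈ (extChartAt J z.2).target) (u : X × Y) :
    mfderiv 𝓘(ℝ, X × Y) (I.prod J) (extChartAt (I.prod J) z).symm q u =
      (mfderiv 𝓘(ℝ, X) I (extChartAt I z.1).symm q.1 u.1,
        mfderiv 𝓘(ℝ, Y) J (extChartAt J z.2).symm q.2 u.2) := by
  have e : ((extChartAt (I.prod J) z).symm : X × Y → B × F) =
      fun q => ((extChartAt I z.1).symm q.1, (extChartAt J z.2).symm q.2) := by
    rw [extChartAt_prod]
    rfl
  have hfst : HasMFDerivAt 𝓘(ℝ, X × Y) 𝓘(ℝ, X) (Prod.fst : X × Y → X) q (fst ℝ X Y) :=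
    hasFDerivAt_fst.hasMFDerivAt
  have hsnd : HasMFDerivAt 𝓘(ℝ, X × Y) 𝓘(ℝ, Y) (Prod.snd : X × Y → Y) q (snd ℝ X Y) :=
    hasFDerivAt_snd.hasMFDerivAt
  have h := HasMFDerivAt.prodMk ((hasMFDerivAt_extChartAt_symm h1).comp q hfst)
    ((hasMFDerivAt_extChartAt_symm h2).comp q hsnd)
  rw [e]
  exact DFunLike.congr_fun h.mfderiv u

theorem bcwp_inChart_apply (gB : PseudoRiemannianMetric I B) (gF : PseudoRiemannianMetric J F)
    (c w : B → ℝ) (hc : ContMDiff I 𝓘(ℝ, ℝ) ∞ c) (hc₀ : ∀ x, 0 < c x)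
    (hw : ContMDiff I 𝓘(ℝ, ℝ) ∞ w) (hw₀ : ∀ x, 0 < w x) (z : B × F) {q : X × Y}
    (h1 : q.1 ∈ (extChartAt I z.1).target) (h2 : q.2 ∈ (extChartAt J z.2).target) (u v : X × Y) :
    (bcwp gB gF c w hc hc₀ hw hw₀).inChart z q u v =
      c ((extChartAt I z.1).symm q.1) ^ 2 * gB.inChart z.1 q.1 u.1 v.1 +
        w ((extChartAt I z.1).symm q.1) ^ 2 * gF.inChart z.2 q.2 u.2 v.2 := by
  have e : (extChartAt (I.prod J) z).symm q =
      ((extChartAt I z.1).symm q.1, (extChartAt J z.2).symm q.2) := by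
    rw [extChartAt_prod]
    rfl
  rw [PseudoRiemannianMetric.inChart_apply, bcwp_val_apply,
    mfderiv_extChartAt_symm_prod_apply z h1 h2, mfderiv_extChartAt_symm_prod_apply z h1 h2, e]
  rfl

theorem contDiffAt_comp_extChartAt_symm {f : B → ℝ} (hf : ContMDiff I 𝓘(ℝ, ℝ) ∞ f) (x : B) :
    ContDiffAt ℝ ∞ (f ∘ (extChartAt I x).symm) (extChartAt I x x) := by
  rw [← contMDiffAt_iff_contDiffAt]
  exact hf.contMDiffAt.comp _
    ((contMDiffOn_extChartAt_symm x).contMDiffAt (extChartAt_target_mem_nhds x))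

theorem baseCoeff_self (e : X) (g : PseudoRiemannianMetric I B) (c : B → ℝ) (b : B) :
    baseCoeff e g c b (extChartAt I b b) = c b ^ 2 * g.val b e e := by
  rw [baseCoeff, extChartAt_to_inv, PseudoRiemannianMetric.inChart_self]

theorem contDiffAt_baseCoeff (e : X) (g : PseudoRiemannianMetric I B) {c : B → ℝ}
    (hc : ContMDiff I 𝓘(ℝ, ℝ) ∞ c) (b : B) :
    ContDiffAt ℝ ∞ (baseCoeff e g c b) (extChartAt I b b) :=
  ((contDiffAt_comp_extChartAt_symm hc b).pow 2).mul
    (((g.contDiffAt_inChart b).clm_apply contDiffAt_const).clm_apply contDiffAt_const)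

/-! ### Base curve in charts and the Ricci curvature of the warped product -/

section Line

variable {e : X} {ε : X →L[ℝ] ℝ}

theorem baseCoeff_self_ne_zero (he : ∀ x, ε x • e = x) (hε : ε e = 1)
    (g : PseudoRiemannianMetric I B) {c : B → ℝ} (hc₀ : ∀ x, 0 < c x) (b : B) :
    baseCoeff e g c b (extChartAt I b b) ≠ 0 := by
  rw [baseCoeff_self]
  exact mul_ne_zero (pow_ne_zero 2 (hc₀ b).ne') (val_ne_zero_of_line he hε g b)

theorem fderiv_comp_extChartAt_symm {w : B → ℝ} (hw : ContMDiff I 𝓘(ℝ, ℝ) ∞ w) {b : B} {t : X}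
    (ht : t ∈ (extChartAt I b).target) (u : X) :
    fderiv ℝ (w ∘ (extChartAt I b).symm) t u = mfderiv I 𝓘(ℝ, ℝ) w ((extChartAt I b).symm t)
      (mfderiv 𝓘(ℝ, X) I (extChartAt I b).symm t u) := by
  have h := ((hw.mdifferentiable (by simp)) ((extChartAt I b).symm t)).hasMFDerivAt.comp t
    (hasMFDerivAt_extChartAt_symm ht)
  rw [← mfderiv_eq_fderiv]
  exact DFunLike.congr_fun h.mfderiv u

theorem fderiv_comp_extChartAt_symm_self {w : B → ℝ} (hw : ContMDiff I 𝓘(ℝ, ℝ) ∞ w) (b : B)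
    (u : X) : fderiv ℝ (w ∘ (extChartAt I b).symm) (extChartAt I b b) u =
      mfderiv I 𝓘(ℝ, ℝ) w b u := by
  rw [fderiv_comp_extChartAt_symm hw (mem_extChartAt_target b),
    PseudoRiemannianMetric.mfderiv_extChartAt_symm_self_apply, extChartAt_to_inv]

/-- `curveGradSq` uses a different chart at each point, so it must be compared with the expression
in one fixed chart before it can be differentiated. A change of chart multiplies dw(e) by a and A by
a², leaving the quotient unchanged. -/
theorem curveGradSq_extChartAt_symm (he : ∀ x, ε x • e = x) (hε : ε e = 1)
    (g : PseudoRiemannianMetric I B) {c w : B → ℝ} (hc : ContMDiff I 𝓘(ℝ, ℝ) ∞ c)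
    (hc₀ : ∀ x, 0 < c x) (hw : ContMDiff I 𝓘(ℝ, ℝ) ∞ w) (b : B) :
    curveGradSq e g c w ∘ (extChartAt I b).symm =ᶠ[𝓝 (extChartAt I b b)]
      LocalMetric.lineGradSq e (w ∘ (extChartAt I b).symm) (baseCoeff e g c b) := by
  filter_upwards [extChartAt_target_mem_nhds (I := I) b,
    (contDiffAt_baseCoeff e g hc b).continuousAt.eventually_ne
      (baseCoeff_self_ne_zero he hε g hc₀ b)] with t ht hA
  set x := (extChartAt I b).symm t with hx
  let D : X →L[ℝ] ℝ := mfderiv I 𝓘(ℝ, ℝ) w x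
  let β : X →L[ℝ] X →L[ℝ] ℝ := g.val x
  -- The tangent space at x is identified with X by the chart at x, so T is the derivative of the
  -- transition from the chart at b to the chart at x, and a is its single entry.
  let T : X →L[ℝ] X := mfderiv 𝓘(ℝ, X) I (extChartAt I b).symm t
  have ha : T e = ε (T e) • e := (he _).symm
  set a := ε (T e)
  have h0 : fderiv ℝ (w ∘ (extChartAt I x).symm) (extChartAt I x x) e = D e :=
    fderiv_comp_extChartAt_symm_self hw x e
  have h1 : fderiv ℝ (w ∘ (extChartAt I b).symm) t e = a * D e := by
    have : fderiv ℝ (w ∘ (extChartAt I b).symm) t e = D (T e) :=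
      fderiv_comp_extChartAt_symm hw ht e
    rw [this, ha, map_smul, smul_eq_mul]
  have h2 : baseCoeff e g c b t = a ^ 2 * (c x ^ 2 * β e e) := by
    have : baseCoeff e g c b t = c x ^ 2 * β (T e) (T e) := rfl
    rw [this, ha]
    simp
    ring
  have h3 : baseCoeff e g c x (extChartAt I x x) = c x ^ 2 * β e e := baseCoeff_self e g c x
  have ha0 : a ≠ 0 := by
    rintro h
    rw [h2, h] at hA
    simp at hA
  rw [Function.comp_apply, curveGradSq, LocalMetric.lineGradSq, LocalMetric.lineGradSq, ← hx, h0,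
    h3, h1, h2, mul_pow, mul_div_mul_left _ _ (pow_ne_zero 2 ha0)]

theorem hasFDerivAt_curveGradSq (he : ∀ x, ε x • e = x) (hε : ε e = 1)
    (g : PseudoRiemannianMetric I B) {c w : B → ℝ} (hc : ContMDiff I 𝓘(ℝ, ℝ) ∞ c)
    (hc₀ : ∀ x, 0 < c x) (hw : ContMDiff I 𝓘(ℝ, ℝ) ∞ w) (b : B) :
    HasFDerivAt (curveGradSq e g c w ∘ (extChartAt I b).symm)
      ((2 * curveLaplacian e g c w b) • fderiv ℝ (w ∘ (extChartAt I b).symm) (extChartAt I b b))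
      (extChartAt I b b) := by
  have hw2 : ContDiffAt ℝ 2 (w ∘ (extChartAt I b).symm) (extChartAt I b b) :=
    (contDiffAt_comp_extChartAt_symm hw b).of_le two_le_infty
  have hA2 : ContDiffAt ℝ 2 (baseCoeff e g c b) (extChartAt I b b) :=
    (contDiffAt_baseCoeff e g hc b).of_le two_le_infty
  have hA0 := baseCoeff_self_ne_zero he hε g hc₀ b
  have hd : DifferentiableAt ℝ
      (LocalMetric.lineGradSq e (w ∘ (extChartAt I b).symm) (baseCoeff e g c b))
      (extChartAt I b b) := by
    have h1 := LocalMetric.differentiableAt_fderiv_apply (e := e) hw2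
    have h2 : DifferentiableAt ℝ (baseCoeff e g c b) (extChartAt I b b) :=
      hA2.differentiableAt (by norm_num)
    unfold LocalMetric.lineGradSq
    fun_prop (disch := exact hA0)
  refine (hd.hasFDerivAt.congr_fderiv ?_).congr_of_eventuallyEq
    (curveGradSq_extChartAt_symm he hε g hc hc₀ hw b)
  ext u
  rw [← he u, map_smul, map_smul, LocalMetric.fderiv_lineGradSq hw2 hA2 hA0]
  rfl

theorem isWarpedAt_bcwp [FiniteDimensional ℝ X] [FiniteDimensional ℝ Y]
    (he : ∀ x, ε x • e = x) (hε : ε e = 1)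
    (gB : PseudoRiemannianMetric I B) (gF : PseudoRiemannianMetric J F)
    (c w : B → ℝ) (hc : ContMDiff I 𝓘(ℝ, ℝ) ∞ c) (hc₀ : ∀ x, 0 < c x)
    (hw : ContMDiff I 𝓘(ℝ, ℝ) ∞ w) (hw₀ : ∀ x, 0 < w x) (z : B × F) :
    LocalMetric.IsWarpedAt e ε (baseCoeff e gB c z.1)
      (fun t => (w ∘ (extChartAt I z.1).symm) t ^ 2) (gF.inChart z.2)
      ((bcwp gB gF c w hc hc₀ hw hw₀).inChart z) (extChartAt I z.1 z.1, extChartAt J z.2 z.2) where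
  eq := by
    filter_upwards [prod_mem_nhds (extChartAt_target_mem_nhds (I := I) z.1)
      (extChartAt_target_mem_nhds (I := J) z.2)] with q hq u v
    rw [bcwp_inChart_apply gB gF c w hc hc₀ hw hw₀ z hq.1 hq.2, inChart_eq_of_line he gB,
      baseCoeff]
    simp only [Function.comp_apply]
    ring
  smul_eq := he
  apply_eq := hε
  contDiffAt_base := (contDiffAt_baseCoeff e gB hc z.1).of_le two_le_infty
  contDiffAt_warp :=
    ((contDiffAt_comp_extChartAt_symm hw z.1).of_le two_le_infty).pow 2
  contDiffAt_fiber := (gF.contDiffAt_inChart z.2).of_le two_le_infty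
  base_ne_zero := baseCoeff_self_ne_zero he hε gB hc₀ z.1
  warp_ne_zero := pow_ne_zero 2 (hw₀ _).ne'
  symm := Filter.Eventually.of_forall fun y v w => gF.inChart_symm z.2 y v w
  nondegenerate := gF.inChart_nondegenerate z.2

/-- The Ricci curvature of a base conformal warped product over a curve. -/
theorem ricci_bcwp [FiniteDimensional ℝ X] [FiniteDimensional ℝ Y]
    (he : ∀ x, ε x • e = x) (hε : ε e = 1)
    (gB : PseudoRiemannianMetric I B) (gF : PseudoRiemannianMetric J F)
    (c w : B → ℝ) (hc : ContMDiff I 𝓘(ℝ, ℝ) ∞ c) (hc₀ : ∀ x, 0 < c x)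
    (hw : ContMDiff I 𝓘(ℝ, ℝ) ∞ w) (hw₀ : ∀ x, 0 < w x) (z : B × F)
    (u v : TangentSpace (I.prod J) z) :
    (bcwp gB gF c w hc hc₀ hw hw₀).ricci z u v =
      gF.ricci z.2 u.2 v.2 -
        Module.finrank ℝ Y * (curveLaplacian e gB c w z.1 / w z.1) *
          (c z.1 ^ 2 * gB.val z.1 u.1 v.1) -
        (w z.1 * curveLaplacian e gB c w z.1 +
          (Module.finrank ℝ Y - 1) * curveGradSq e gB c w z.1) * gF.val z.2 u.2 v.2 := by
  have hw2 : ContDiffAt ℝ 2 (w ∘ (extChartAt I z.1).symm) (extChartAt I z.1 z.1) :=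
    (contDiffAt_comp_extChartAt_symm hw z.1).of_le two_le_infty
  have h := (isWarpedAt_bcwp he hε gB gF c w hc hc₀ hw hw₀ z).ricci_eq_of_sq hw2 u v
  have e2 : extChartAt (I.prod J) z z = (extChartAt I z.1 z.1, extChartAt J z.2 z.2) := by
    rw [extChartAt_prod]
    rfl
  have hR := gF.ricci_eq_inChart z.2 u.2 v.2
  have hG := gF.inChart_self z.2 u.2 v.2
  have hB := val_eq_of_line he gB z.1 u.1 v.1
  dsimp only at h
  rw [Function.comp_apply, extChartAt_to_inv, baseCoeff_self] at h
  refine (PseudoRiemannianMetric.ricci_eq_inChart _ z u v).trans ?_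
  rw [e2, hR, hB, curveLaplacian, curveGradSq]
  refine h.trans ?_
  rw [← hG]
  ring

end Line

end Warped

/-! ### Rigidity over compact curves -/

section Rigidity

variable {X : Type*} [NormedAddCommGroup X] [NormedSpace ℝ X]
  {H : Type*} [TopologicalSpace H] {I : ModelWithCorners ℝ X H}
  {B : Type*} [TopologicalSpace B] [ChartedSpace H B] [IsManifold I ∞ B]
  {e : X} {ε : X →L[ℝ] ℝ} {g : PseudoRiemannianMetric I B} {c w : B → ℝ}

theorem curveLaplacian_eq_zero_of_const {a : ℝ} (h : ∀ x, w x = a) (b : B) :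
    curveLaplacian e g c w b = 0 := by
  have : w ∘ (extChartAt I b).symm = fun _ => a := funext fun t => h _
  rw [curveLaplacian, LocalMetric.lineLaplacian, this]
  simp

theorem curveGradSq_eq_zero_of_const {a : ℝ} (h : ∀ x, w x = a) (b : B) :
    curveGradSq e g c w b = 0 := by
  have : w ∘ (extChartAt I b).symm = fun _ => a := funext fun t => h _
  rw [curveGradSq, LocalMetric.lineGradSq, this]
  simp

variable [I.Boundaryless]

theorem eq_of_hasFDerivAt_zero [PreconnectedSpace B] {Q : B → ℝ}
    (h : ∀ x, HasFDerivAt (Q ∘ (extChartAt I x).symm) (0 : X →L[ℝ] ℝ) (extChartAt I x x))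
    (x y : B) : Q x = Q y :=
  (isLocallyConstant_of_hasMFDerivAt_zero (I := I) fun x =>
    hasMFDerivAt_zero_of_chart (h x)).apply_eq_of_preconnectedSpace x y

theorem eq_of_curveGradSq_eq_zero [PreconnectedSpace B] (he : ∀ x, ε x • e = x) (hε : ε e = 1)
    (hc₀ : ∀ x, 0 < c x) (hw : ContMDiff I 𝓘(ℝ, ℝ) ∞ w)
    (h : ∀ b, curveGradSq e g c w b = 0) (x y : B) : w x = w y := by
  refine eq_of_hasFDerivAt_zero (I := I) (fun b => ?_) x y
  have hd : DifferentiableAt ℝ (w ∘ (extChartAt I b).symm) (extChartAt I b b) :=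
    (contDiffAt_comp_extChartAt_symm hw b).differentiableAt (by simp)
  refine hd.hasFDerivAt.congr_fderiv ?_
  have hb : fderiv ℝ (w ∘ (extChartAt I b).symm) (extChartAt I b b) e = 0 := by
    have := h b
    rw [curveGradSq, LocalMetric.lineGradSq,
      div_eq_zero_iff, or_iff_left (baseCoeff_self_ne_zero he hε g hc₀ b)] at this
    simpa using this
  ext u
  rw [← he u, map_smul, hb]
  simp

variable [CompactSpace B] [ConnectedSpace B]

/-- A positive function on a compact curve with `Δ w = -L w` for a constant `L` is constant. -/
theorem const_of_curveLaplacian_eq_mul (he : ∀ x, ε x • e = x) (hε : ε e = 1)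
    (hc : ContMDiff I 𝓘(ℝ, ℝ) ∞ c) (hc₀ : ∀ x, 0 < c x)
    (hw : ContMDiff I 𝓘(ℝ, ℝ) ∞ w) (hw₀ : ∀ x, 0 < w x) {L : ℝ}
    (h : ∀ b, curveLaplacian e g c w b = -L * w b) (x y : B) : w x = w y := by
  -- The energy |dw|² + L w² has derivative 2 (Δw + L w) dw = 0.
  have hQ : ∀ x y, curveGradSq e g c w x + L * w x ^ 2 = curveGradSq e g c w y + L * w y ^ 2 := by
    refine eq_of_hasFDerivAt_zero (I := I) (Q := fun x => curveGradSq e g c w x + L * w x ^ 2)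
      fun b => ?_
    have hd : DifferentiableAt ℝ (w ∘ (extChartAt I b).symm) (extChartAt I b b) :=
      (contDiffAt_comp_extChartAt_symm hw b).differentiableAt (by simp)
    refine ((hasFDerivAt_curveGradSq he hε g hc hc₀ hw b).add
      ((hd.hasFDerivAt.pow 2).const_mul L)).congr_fderiv ?_
    ext u
    simp only [h, Function.comp_apply, extChartAt_to_inv, add_apply, smul_apply, smul_eq_mul,
      zero_apply, nsmul_eq_mul]
    push_cast
    ring
  obtain ⟨M, -, hM⟩ := isCompact_univ.exists_isMaxOn Set.univ_nonempty hw.continuous.continuousOn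
  obtain ⟨m, -, hm⟩ := isCompact_univ.exists_isMinOn Set.univ_nonempty hw.continuous.continuousOn
  have hPM := curveGradSq_eq_zero_of_isExtr e g c (b := M) (Or.inr hM)
  have hPm := curveGradSq_eq_zero_of_isExtr e g c (b := m) (Or.inl hm)
  have hconst : w M = w m → w x = w y := fun hMm => by
    have hle : ∀ x, w x ≤ w M := fun x => hM (Set.mem_univ x)
    have hge : ∀ x, w m ≤ w x := fun x => hm (Set.mem_univ x)
    exact (le_antisymm (hle x) (hMm ▸ hge x)).trans (le_antisymm (hle y) (hMm ▸ hge y)).symm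
  -- If L = 0, then |dw|² is constant and vanishes at the maximum. Otherwise equality of the
  -- energies at M and m gives w(M)² = w(m)².
  by_cases hL : L = 0
  · refine eq_of_curveGradSq_eq_zero (g := g) he hε hc₀ hw (fun b => ?_) x y
    have := hQ b M
    rwa [hPM, hL, zero_mul, zero_mul, add_zero, add_zero] at this
  · have h1 := hQ M m
    rw [hPM, hPm, zero_add, zero_add] at h1
    exact hconst ((pow_left_inj₀ (hw₀ M).le (hw₀ m).le two_ne_zero).1 (mul_left_cancel₀ hL h1))

/-- A positive function `w` on a compact curve for which `|dw|² - w Δ w` is constant is itself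
constant. -/
theorem const_of_curveGradSq_sub_eq (he : ∀ x, ε x • e = x) (hε : ε e = 1)
    (hc : ContMDiff I 𝓘(ℝ, ℝ) ∞ c) (hc₀ : ∀ x, 0 < c x)
    (hw : ContMDiff I 𝓘(ℝ, ℝ) ∞ w) (hw₀ : ∀ x, 0 < w x) {C : ℝ}
    (h : ∀ b, curveGradSq e g c w b - w b * curveLaplacian e g c w b = C) (x y : B) :
    w x = w y := by
  have hQ : ∀ x y, (curveGradSq e g c w x - C) / w x ^ 2 =
      (curveGradSq e g c w y - C) / w y ^ 2 := by
    refine eq_of_hasFDerivAt_zero (I := I) (Q := fun x => (curveGradSq e g c w x - C) / w x ^ 2)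
      fun b => ?_
    have hd : DifferentiableAt ℝ (w ∘ (extChartAt I b).symm) (extChartAt I b b) :=
      (contDiffAt_comp_extChartAt_symm hw b).differentiableAt (by simp)
    have hP := hasFDerivAt_curveGradSq he hε g hc hc₀ hw b
    have hw0 : (w ∘ (extChartAt I b).symm) (extChartAt I b b) ^ 2 ≠ 0 := pow_ne_zero 2 (hw₀ _).ne'
    have hdiff : DifferentiableAt ℝ
        (fun t => ((curveGradSq e g c w ∘ (extChartAt I b).symm) t - C) /
          (w ∘ (extChartAt I b).symm) t ^ 2) (extChartAt I b b) := by
      have key : ∀ (P v : X → ℝ) (t : X), DifferentiableAt ℝ P t → DifferentiableAt ℝ v t →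
          v t ^ 2 ≠ 0 → DifferentiableAt ℝ (fun t => (P t - C) / v t ^ 2) t := by
        intro P v t h1 h2 h3
        fun_prop (disch := exact h3)
      exact key _ _ _ hP.differentiableAt hd hw0
    refine hdiff.hasFDerivAt.congr_fderiv ?_
    ext u
    rw [LocalMetric.fderiv_div_apply (hP.differentiableAt.sub_const C) (hd.fun_pow 2) hw0,
      LocalMetric.fderiv_sq_apply hd, fderiv_sub_const, hP.fderiv, zero_apply, div_eq_zero_iff]
    -- The numerator of the derivative is 2 w dw (w Δw - |dw|² + C), which vanishes by hypothesis.
    left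
    simp only [Function.comp_apply, extChartAt_to_inv, smul_apply, smul_eq_mul, ← h b]
    ring
  obtain ⟨M, -, hM⟩ := isCompact_univ.exists_isMaxOn Set.univ_nonempty hw.continuous.continuousOn
  obtain ⟨m, -, hm⟩ := isCompact_univ.exists_isMinOn Set.univ_nonempty hw.continuous.continuousOn
  have hPM := curveGradSq_eq_zero_of_isExtr e g c (b := M) (Or.inr hM)
  have hPm := curveGradSq_eq_zero_of_isExtr e g c (b := m) (Or.inl hm)
  have hconst : w M = w m → w x = w y := fun hMm => by
    have hle : ∀ x, w x ≤ w M := fun x => hM (Set.mem_univ x)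
    have hge : ∀ x, w m ≤ w x := fun x => hm (Set.mem_univ x)
    exact (le_antisymm (hle x) (hMm ▸ hge x)).trans (le_antisymm (hle y) (hMm ▸ hge y)).symm
  by_cases hC : C = 0
  · refine eq_of_curveGradSq_eq_zero (g := g) he hε hc₀ hw (fun b => ?_) x y
    have := hQ b M
    rw [hPM, hC, sub_zero, sub_zero, zero_div, div_eq_zero_iff] at this
    exact this.resolve_right (pow_ne_zero 2 (hw₀ b).ne')
  · have h1 := hQ M m
    rw [hPM, hPm, zero_sub, div_eq_div_iff (pow_ne_zero 2 (hw₀ M).ne')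
      (pow_ne_zero 2 (hw₀ m).ne')] at h1
    exact hconst ((pow_left_inj₀ (hw₀ M).le (hw₀ m).le two_ne_zero).1
      (mul_left_cancel₀ (neg_ne_zero.2 hC) h1).symm)

end Rigidity

/-! ### Einstein base conformal warped products over curves -/

section Einstein

variable {X : Type*} [NormedAddCommGroup X] [NormedSpace ℝ X]
  {H : Type*} [TopologicalSpace H] {I : ModelWithCorners ℝ X H}
  {B : Type*} [TopologicalSpace B] [ChartedSpace H B] [IsManifold I ∞ B]
  {Y : Type*} [NormedAddCommGroup Y] [NormedSpace ℝ Y]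
  {H' : Type*} [TopologicalSpace H'] {J : ModelWithCorners ℝ Y H'}
  {F : Type*} [TopologicalSpace F] [ChartedSpace H' F] [IsManifold J ∞ F]

/-- The multiple of a pseudo-Riemannian metric by a nonzero constant. -/
def PseudoRiemannianMetric.constSMul (g : PseudoRiemannianMetric I B) (a : ℝ) (ha : a ≠ 0) :
    PseudoRiemannianMetric I B where
  val x := a • g.val x
  symm x v w := congrArg (a * ·) (g.symm x v w)
  nondegenerate x v hv := g.nondegenerate x v fun w => by
    have h : a * g.val x v w = 0 := hv w
    simpa [ha] using h
  contMDiff := ContMDiff.smul_section contMDiff_const g.contMDiff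

theorem PseudoRiemannianMetric.ext_val {g g' : PseudoRiemannianMetric I B}
    (h : ∀ x, g.val x = g'.val x) : g = g' := by
  cases g
  cases g'
  congr
  exact funext h

/-- A base conformal warped product with constant scale functions is a product. -/
theorem bcwp_eq_productMetric (gB : PseudoRiemannianMetric I B) (gF : PseudoRiemannianMetric J F)
    (c w : B → ℝ) (hc : ContMDiff I 𝓘(ℝ, ℝ) ∞ c) (hc₀ : ∀ x, 0 < c x)
    (hw : ContMDiff I 𝓘(ℝ, ℝ) ∞ w) (hw₀ : ∀ x, 0 < w x) {a b : ℝ} (ha : a ^ 2 ≠ 0)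
    (hb : b ^ 2 ≠ 0) (hca : ∀ x, c x = a) (hwb : ∀ x, w x = b) :
    bcwp gB gF c w hc hc₀ hw hw₀ =
      productMetric (gB.constSMul (a ^ 2) ha) (gF.constSMul (b ^ 2) hb) := by
  refine PseudoRiemannianMetric.ext_val fun z => ?_
  refine ContinuousLinearMap.ext fun u => ContinuousLinearMap.ext fun v => ?_
  rw [productMetric, bcwp_val_apply, bcwp_val_apply, hca, hwb]
  change _ = 1 ^ 2 * (a ^ 2 * gB.val z.1 u.1 v.1) + 1 ^ 2 * (b ^ 2 * gF.val z.2 u.2 v.2)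
  ring

variable [I.Boundaryless] [J.Boundaryless] [FiniteDimensional ℝ X] [FiniteDimensional ℝ Y]

/-- The Einstein equation is rearranged so that a multiple of g_B equals a multiple of g_F. Purely
horizontal vectors then isolate the first coefficient and purely vertical ones the second. -/
theorem isEinstein_bcwp_iff [Nontrivial Y] {e : X} {ε : X →L[ℝ] ℝ}
    (he : ∀ x, ε x • e = x) (hε : ε e = 1)
    (gB : PseudoRiemannianMetric I B) (gF : PseudoRiemannianMetric J F) {ν : F → ℝ}
    (hF : gF.IsEinstein ν) (c w : B → ℝ) (hc : ContMDiff I 𝓘(ℝ, ℝ) ∞ c) (hc₀ : ∀ x, 0 < c x)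
    (hw : ContMDiff I 𝓘(ℝ, ℝ) ∞ w) (hw₀ : ∀ x, 0 < w x) (lam : B × F → ℝ) :
    (bcwp gB gF c w hc hc₀ hw hw₀).IsEinstein lam ↔
      ContMDiff (I.prod J) 𝓘(ℝ, ℝ) ∞ lam ∧ ∀ z : B × F,
        lam z = -(Module.finrank ℝ Y * (curveLaplacian e gB c w z.1 / w z.1)) ∧
        ν z.2 = lam z * w z.1 ^ 2 + (w z.1 * curveLaplacian e gB c w z.1 +
          (Module.finrank ℝ Y - 1) * curveGradSq e gB c w z.1) := by
  have key : ∀ (z : B × F) (u v : TangentSpace (I.prod J) z),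
      (bcwp gB gF c w hc hc₀ hw hw₀).ricci z u v =
        lam z * (bcwp gB gF c w hc hc₀ hw hw₀).val z u v ↔
      (lam z + Module.finrank ℝ Y * (curveLaplacian e gB c w z.1 / w z.1)) *
        (c z.1 ^ 2 * gB.val z.1 u.1 v.1) =
      (ν z.2 - (lam z * w z.1 ^ 2 + (w z.1 * curveLaplacian e gB c w z.1 +
          (Module.finrank ℝ Y - 1) * curveGradSq e gB c w z.1))) * gF.val z.2 u.2 v.2 := by
    intro z u v
    have h1 := ricci_bcwp he hε gB gF c w hc hc₀ hw hw₀ z u v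
    have h2 := bcwp_val_apply gB gF c w hc hc₀ hw hw₀ z u v
    have h3 := hF.2 z.2 u.2 v.2
    constructor <;> intro h <;> linear_combination -h + h1 - lam z * h2 + h3
  refine and_congr_right fun _ => ⟨fun h z => ?_, fun h z u v => ?_⟩
  · constructor
    · have h1 := (key z (e, (0 : Y)) (e, (0 : Y))).1 (h z _ _)
      have h0 : gF.val z.2 (0 : Y) (0 : Y) = 0 := map_zero _
      have h2 : c z.1 ^ 2 * gB.val z.1 e e ≠ 0 :=
        mul_ne_zero (pow_ne_zero 2 (hc₀ _).ne') (val_ne_zero_of_line he hε gB z.1)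
      exact eq_neg_of_add_eq_zero_left
        ((mul_eq_zero.1 (h1.trans (by rw [h0, mul_zero]))).resolve_right h2)
    · obtain ⟨y, hy⟩ := exists_ne (0 : Y)
      -- The fibre metric may be indefinite, so y could be null and a second vector is needed.
      obtain ⟨y', hy'⟩ : ∃ y' : Y, gF.val z.2 y y' ≠ 0 := by
        by_contra hcon
        push Not at hcon
        exact hy (gF.nondegenerate z.2 y hcon)
      have h1 := (key z ((0 : X), y) ((0 : X), y')).1 (h z _ _)
      have h0 : gB.val z.1 (0 : X) (0 : X) = 0 := map_zero _
      exact sub_eq_zero.1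
        ((mul_eq_zero.1 (h1.symm.trans (by rw [h0, mul_zero, mul_zero]))).resolve_right hy')
  · obtain ⟨h1, h2⟩ := h z
    rw [key, h2, h1, neg_add_cancel, sub_self, zero_mul, zero_mul]

end Einstein

end

/-! ### The main theorem -/

theorem mainTheorem11 (k : ℕ) (hk : 1 ≤ k)
    {B : Type*} [TopologicalSpace B] [ChartedSpace (EuclideanSpace ℝ (Fin 1)) B]
    [IsManifold (𝓡 1) ∞ B] [T2Space B] [ConnectedSpace B] [CompactSpace B]
    {F : Type*} [TopologicalSpace F] [ChartedSpace (EuclideanSpace ℝ (Fin k)) F]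
    [IsManifold (𝓡 k) ∞ F] [T2Space F] [ConnectedSpace F]
    (gB : ContMDiffRiemannianMetric (𝓡 1) ∞ (EuclideanSpace ℝ (Fin 1))
      (fun x : B ↦ TangentSpace (𝓡 1) x))
    (gF : PseudoRiemannianMetric (𝓡 k) F)
    (ν : F → ℝ) (hF : gF.IsEinstein ν)
    (μ : ℝ)
    (hμ : μ ∉ ({0, 1, (k : ℝ), k - √((k : ℝ) ^ 2 - k), k + √((k : ℝ) ^ 2 - k)} : Set ℝ))
    (ψ : B → ℝ) (hψ : ContMDiff (𝓡 1) 𝓘(ℝ, ℝ) ∞ ψ) (hψ₀ : ∀ x, 0 < ψ x)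
    (lam : B × F → ℝ) (hlam : k = 1 → ∀ z z', lam z = lam z') :
    ((sbcwp (.ofRiemannian gB) gF ψ μ hψ hψ₀).IsEinstein lam ↔
      (∀ z, lam z = 0) ∧ (∀ y, ν y = 0) ∧ ∃ a : ℝ, 0 < a ∧ ∀ x, ψ x = a) ∧
    ((sbcwp (.ofRiemannian gB) gF ψ μ hψ hψ₀).IsEinstein lam →
      ∃ (gB' : PseudoRiemannianMetric (𝓡 1) B) (gF' : PseudoRiemannianMetric (𝓡 k) F) (a b : ℝ),
        0 < a ∧ 0 < b ∧ (∀ x, gB'.val x = a • (PseudoRiemannianMetric.ofRiemannian gB).val x) ∧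
        (∀ y, gF'.val y = b • gF.val y) ∧
        sbcwp (.ofRiemannian gB) gF ψ μ hψ hψ₀ = productMetric gB' gF') := by
  have he : ∀ x : EuclideanSpace ℝ (Fin 1),
      (EuclideanSpace.proj 0 : EuclideanSpace ℝ (Fin 1) →L[ℝ] ℝ) x •
        (EuclideanSpace.single 0 1 : EuclideanSpace ℝ (Fin 1)) = x := by
    intro x
    ext i
    fin_cases i
    simp
  have hε : (EuclideanSpace.proj 0 : EuclideanSpace ℝ (Fin 1) →L[ℝ] ℝ)
      (EuclideanSpace.single 0 1 : EuclideanSpace ℝ (Fin 1)) = 1 := by simp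
  -- Makes the model space of the fibre nontrivial, as the vertical equation requires.
  have : Nonempty (Fin k) := ⟨⟨0, hk⟩⟩
  have hiff := isEinstein_bcwp_iff he hε (.ofRiemannian gB) gF hF (fun x => ψ x ^ μ) ψ
    (hψ.rpow_const_of_pos hψ₀ μ) (fun x => Real.rpow_pos_of_pos (hψ₀ x) μ) hψ hψ₀ lam
  rw [finrank_euclideanSpace_fin] at hiff
  set g : PseudoRiemannianMetric (𝓡 1) B := .ofRiemannian gB
  set e : EuclideanSpace ℝ (Fin 1) := EuclideanSpace.single 0 1
  have hconst : (sbcwp g gF ψ μ hψ hψ₀).IsEinstein lam → ∀ x y, ψ x = ψ y := by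
    intro hE
    have h := (hiff.1 hE).2
    obtain ⟨y₀⟩ : Nonempty F := inferInstance
    obtain ⟨x₀⟩ : Nonempty B := inferInstance
    rcases hk.eq_or_lt with rfl | hk1
    · refine const_of_curveLaplacian_eq_mul (g := g) (c := fun x => ψ x ^ μ) (L := lam (x₀, y₀))
        he hε (hψ.rpow_const_of_pos hψ₀ μ) (fun x => Real.rpow_pos_of_pos (hψ₀ x) μ) hψ hψ₀
        fun b => ?_
      have h1 := (h (b, y₀)).1
      rw [hlam rfl (b, y₀) (x₀, y₀)] at h1
      have := (hψ₀ b).ne'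
      rw [h1]
      push_cast
      field_simp
    · have hk0 : (k : ℝ) - 1 ≠ 0 := by
        have : (1 : ℝ) < k := by exact_mod_cast hk1
        linarith
      -- Fixing one fibre point y₀ turns ν = (k - 1)(|dψ|² - ψ Δψ) into an equation on B with
      -- constant C = ν(y₀) / (k - 1).
      refine const_of_curveGradSq_sub_eq (g := g) (c := fun x => ψ x ^ μ) (C := ν y₀ / (k - 1))
        he hε (hψ.rpow_const_of_pos hψ₀ μ) (fun x => Real.rpow_pos_of_pos (hψ₀ x) μ) hψ hψ₀
        fun b => ?_
      obtain ⟨h1, h2⟩ := h (b, y₀)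
      have := (hψ₀ b).ne'
      rw [eq_div_iff hk0, h2, h1]
      dsimp only
      field_simp
      ring
  refine ⟨⟨fun hE => ?_, fun ⟨h1, h2, a, _, h3⟩ => ?_⟩, fun hE => ?_⟩
  · obtain ⟨x₀⟩ : Nonempty B := inferInstance
    have hc : ∀ x, ψ x = ψ x₀ := fun x => hconst hE x x₀
    have h := (hiff.1 hE).2
    have hl : ∀ z, lam z = 0 := fun z => by
      rw [(h z).1, curveLaplacian_eq_zero_of_const hc]
      simp
    refine ⟨hl, fun y => ?_, ψ x₀, hψ₀ x₀, hc⟩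
    rw [(h (x₀, y)).2, hl, curveLaplacian_eq_zero_of_const hc, curveGradSq_eq_zero_of_const hc]
    simp
  · refine hiff.2 ⟨?_, fun z => ?_⟩
    · rw [show lam = fun _ => 0 from funext h1]
      exact contMDiff_const
    · rw [h1, h2, curveLaplacian_eq_zero_of_const h3, curveGradSq_eq_zero_of_const h3]
      simp
  · obtain ⟨x₀⟩ : Nonempty B := inferInstance
    have hc : ∀ x, ψ x = ψ x₀ := fun x => hconst hE x x₀
    have ha : 0 < (ψ x₀ ^ μ) ^ 2 := pow_pos (Real.rpow_pos_of_pos (hψ₀ x₀) μ) 2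
    have hb : 0 < ψ x₀ ^ 2 := pow_pos (hψ₀ x₀) 2
    exact ⟨g.constSMul _ ha.ne', gF.constSMul _ hb.ne', _, _, ha, hb, fun _ => rfl, fun _ => rfl,
      bcwp_eq_productMetric g gF _ ψ _ _ hψ hψ₀ ha.ne' hb.ne' (fun x => by rw [hc x]) hc⟩
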